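/- **Setting (censor block model).** Let $V$ have $2n$ vertices, and let $x\in\{0,1\}^V$ have exactly $n$ coordinates equal to $1$; put $V_1=\{i:x_i=0\}$ and $V_2=\{i:x_i=1\}$. Let $G\sim G(2n,p)$ (every pair of vertices is an edge independently with probability $p$), let $B_G$ be its edge–vertex incidence matrix, and, given $G$, let $z$ be a vector indexed by the edges of $G$ with i.i.d. $\mathrm{Bernoulli}(\varepsilon)$ coordinates. One observes $G$ and $y=B_Gx\oplus z$ (addition mod $2$), i.e. $y_{ij}=x_i\oplus x_j\oplus z_{ij}$ for every edge $ij$. Let $Y$ be the symmetric $2n\times 2n$ matrix with $Y_{ij}=y_{ij}\in\{0,1\}$ if $ij$ is an edge and $Y_{ij}=0$ otherwise. **Algorithm.** On input $(Y,p)$: (1) zero out all rows and columns of $Y$ at vertices $i$ whose degree $\sum_jY_{ij}$ is larger than $20pn$, to get $Y_0$; (2) let $U$ be the $2$-dimensional space spanned by (orthonormal) eigenvectors of $Y_0$ for its two eigenvalues of largest absolute value (counted with multiplicity); (3) let $v_1$ be the orthogonal projection of the all-ones vector on $U$ and $v_2$ a unit vector of $U$ perpendicular to $v_1$; (4) sort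 the vertices by their values in $v_2$, let $V_1'$ be the top $n$ vertices and $V_2'=V\setminus V_1'$, and output $\{V_1',V_2'\}$. Ties, and the choice of $v_2$, are resolved arbitrarily. The partition $\{V_1',V_2'\}$ is called $\gamma$-correct if, possibly after exchanging the names of $V_1'$ and $V_2'$, $|V_i\cap V_i'|\ge(1-\gamma)n$ for $i=1,2$. **Theorem.** For every $\gamma>0$ and every $0<\varepsilon_0<\tfrac12$ there are constants $C_1,C_2>0$, depending only on $\gamma$ and $\varepsilon_0$, such that for every fixed $\varepsilon\in[\varepsilon_0,\tfrac12)$ the following holds. If $$np\ \ge\ \frac{C_1}{(1-2\varepsilon)^2}\qquad\text{and}\qquad p\ \ge\ \frac{C_2}{n},$$ then with probability $1-o(1)$ as $n\to\infty$ every possible output of the algorithm (there is at least one) is a $\gamma$-correct partition. Here $o(1)$ is uniform over all $p\in[0,1]$ satisfying the two conditions and over all $x$ with exactly $n$ ones. (In particular, taking $\varepsilon_0=\varepsilon$, for any given constants $\gamma>0$ and $0<\varepsilon<\tfrac12$ there are such $C_1,C_2$.) -/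

import Mathlib

open MeasureTheory ProbabilityTheory Filter Topology

namespace CensorBlock

noncomputable section

/-- The community `{i | x i = a}` of a labelling `x` of the vertices. -/
def block {V : Type*} [Fintype V] (x : V → ZMod 2) (a : ZMod 2) : Finset V :=
  Finset.univ.filter fun i => x i = a

/-- The joint law of the random graph `G ∼ G(2n, p)` and of independent i.i.d. Bernoulli(`ε`) marks
(`1` with probability `ε`, `0` otherwise) on the unordered pairs of vertices; only the marks on
the edges of `G` enter the observation below, so given `G` the noise is i.i.d. Bernoulli(`ε`) on
the edges. -/
def law (n : ℕ) (p ε : unitInterval) :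
    Measure (SimpleGraph (Fin (2 * n)) × (Sym2 (Fin (2 * n)) → ZMod 2)) :=
  (SimpleGraph.binomialRandom (Fin (2 * n)) p).prod
    (Measure.pi fun _ : Sym2 (Fin (2 * n)) => bernoulliMeasure (1 : ZMod 2) 0 ε)

open Classical in
/-- The noisy observation `y = B_G x ⊕ z`, a vector over `ℤ/2` indexed by the edges of `G`, where
`B_G` is the edge-vertex incidence matrix. -/
def observation {V : Type*} [Fintype V] (G : SimpleGraph V) (x : V → ZMod 2)
    (z : Sym2 V → ZMod 2) (e : G.edgeSet) : ZMod 2 :=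
  ((G.incMatrix (ZMod 2)).transpose.mulVec x) e + z e

open Classical in
/-- The symmetric 0/1 matrix `Y` of a labelled graph: `Y i j` is the label of the edge `ij`, and
`0` if `ij` is not an edge. -/
def labelMatrix {V : Type*} (G : SimpleGraph V) (y : G.edgeSet → ZMod 2) : Matrix V V ℝ :=
  Matrix.of fun i j =>
    if h : G.Adj i j then (if y ⟨s(i, j), h⟩ = 1 then 1 else 0) else 0

/-- The degree of a vertex in (the graph with adjacency matrix) `Y`. -/
def degree {V : Type*} [Fintype V] (Y : Matrix V V ℝ) (i : V) : ℝ := ∑ j, Y i j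

open Classical in
/-- Zero out the rows and the columns of `Y` at the vertices of degree larger than `t`. -/
def trim {V : Type*} [Fintype V] (Y : Matrix V V ℝ) (t : ℝ) : Matrix V V ℝ :=
  Matrix.of fun i j => if t < degree Y i ∨ t < degree Y j then 0 else Y i j

open Classical in
/-- `U` is spanned by the eigenvectors of the two eigenvalues of `A` that are largest in absolute
value: there is an orthonormal eigenbasis `b`, with eigenvalues `μ`, such that `U` is the span of
two of its vectors, whose eigenvalues dominate all the others in absolute value. (If there are
ties, several planes qualify.) -/
def IsTopEigenspace {V : Type*} [Fintype V] (A : Matrix V V ℝ)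
    (U : Submodule ℝ (EuclideanSpace ℝ V)) : Prop :=
  ∃ (b : OrthonormalBasis V ℝ (EuclideanSpace ℝ V)) (μ : V → ℝ) (S : Finset V),
    (∀ i, Matrix.toEuclideanLin A (b i) = μ i • b i) ∧ S.card = 2 ∧
    (∀ i ∈ S, ∀ j ∉ S, |μ j| ≤ |μ i|) ∧ U = Submodule.span ℝ (b '' (S : Set V))

/-- `(V₁, V₂)` is a possible output of the spectral algorithm on the input `Y`, `p`. The choices
the algorithm leaves open (the sign of `v₂`, ties in the sorting, ties among eigenvalues) may be
made in any way. -/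
def IsSpectralOutput (n : ℕ) (p : ℝ) (Y : Matrix (Fin (2 * n)) (Fin (2 * n)) ℝ)
    (V₁ V₂ : Finset (Fin (2 * n))) : Prop :=
  ∃ (U : Submodule ℝ (EuclideanSpace ℝ (Fin (2 * n)))) (v₁ v₂ : EuclideanSpace ℝ (Fin (2 * n))),
    IsTopEigenspace (trim Y (20 * p * n)) U ∧
    v₁ = U.starProjection (WithLp.toLp 2 fun _ => (1 : ℝ)) ∧
    v₂ ∈ U ∧ ‖v₂‖ = 1 ∧ inner ℝ v₁ v₂ = 0 ∧
    V₁.card = n ∧ (∀ i ∈ V₁, ∀ j ∉ V₁, v₂ j ≤ v₂ i) ∧ V₂ = V₁ᶜ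

/-- `(V₁', V₂')` is `γ`-correct for the blocks `V₁, V₂` of size `n`. -/
def GammaCorrect {V : Type*} [DecidableEq V] (n : ℕ) (γ : ℝ) (V₁ V₂ V₁' V₂' : Finset V) : Prop :=
  (1 - γ) * n ≤ ((V₁ ∩ V₁').card : ℝ) ∧ (1 - γ) * n ≤ ((V₂ ∩ V₂').card : ℝ)

/-- `γ`-correctness of the unordered partition `{V₁', V₂'}`: the names of the two parts, which the
observation cannot determine, are disregarded. -/
def GammaCorrectPartition {V : Type*} [DecidableEq V] (n : ℕ) (γ : ℝ)
    (V₁ V₂ V₁' V₂' : Finset V) : Prop :=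
  GammaCorrect n γ V₁ V₂ V₁' V₂' ∨ GammaCorrect n γ V₁ V₂ V₂' V₁'

/-- The event that the spectral algorithm has an output, and that each of its possible outputs is
a `γ`-correct partition. -/
def successEvent (n : ℕ) (p γ : ℝ) (x : Fin (2 * n) → ZMod 2) :
    Set (SimpleGraph (Fin (2 * n)) × (Sym2 (Fin (2 * n)) → ZMod 2)) :=
  {ω | (∃ V₁' V₂', IsSpectralOutput n p (labelMatrix ω.1 (observation ω.1 x ω.2)) V₁' V₂') ∧
    ∀ V₁' V₂', IsSpectralOutput n p (labelMatrix ω.1 (observation ω.1 x ω.2)) V₁' V₂' →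
      GammaCorrectPartition n γ (block x 0) (block x 1) V₁' V₂'}

end

end CensorBlock

/-! Put `D = √(np)`, `N = 2n`, and let `s` be the ±1 vector of the communities. Up to its diagonal,
the mean of `Y` is `(p/2)𝟙𝟙ᵀ - ((1-2ε)p/2)ssᵀ`. Since the blocks have equal size, `𝟙` and `s` are
orthogonal eigenvectors of this rank two matrix, with eigenvalues `np` and `-(1-2ε)np`
(`meanMatrix_apply_vector`).

The heart of the proof is that the trimmed matrix is within `κ = 10625 D` of the mean matrix in
operator norm. Once `D(1-2ε)` is a large constant, `κ` is small beside `l = (1-2ε)np`. A unit vector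
of the top eigenplane is then the image under the trimmed matrix of a vector of length at most
`1/(l-κ)`, so it is close to the span of `𝟙` and `s`. Being orthogonal to the projection of `𝟙`, it
is orthogonal to `𝟙`, hence close to a multiple of `s` (`exists_smul_add_of_mem_top`). Sorting can
misplace few vertices, because misplaced vertices force large coordinates of the error
(`card_sdiff_mul_sq_le`).

The norm bound is by the method of Friedman–Kahn–Szemerédi and Feige–Ofek. Rounding reduces it to
quadratic forms at integer vectors `z` with `∑ z i ^ 2 ≤ 16N` (`norm_toEuclideanCLM_le`). For light
pairs, `|z i * z j| ≤ D`, a Chernoff bound beats the number of such vectors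
(`measure_not_lightBound_le`). For heavy pairs that union bound is too weak. Instead, edge counts
between all pairs of vertex sets are controlled (`measure_not_discrepancy_le`) and applied to the
dyadic level sets of `z`. If one level exceeds the other by a factor `D`, the pair is charged to row
or column sums, which trimming keeps at most `20D²`; the balanced levels add up geometrically
(`sum_balanced_edges_le`). Probability enters only through the exponential moments of the upper
triangle, whose entries are independent (`expMomentBound_law`). -/

namespace CensorBlock

noncomputable section

/-! ### Dyadic level sets: the total weight of balanced pairs. -/

section

/-- An upper bound for the logarithm of the number of `a`-element subsets of an `N`-element set. -/
def entropyWeight (N a : ℝ) : ℝ := a * (1 + Real.log (N / a))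

lemma entropyWeight_le {N a : ℝ} (hN : 0 < N) (ha : 0 < a) : entropyWeight N a ≤ N := by
  have h := Real.log_le_sub_one_of_pos (div_pos hN ha)
  calc entropyWeight N a ≤ a * (1 + (N / a - 1)) := by unfold entropyWeight; gcongr
    _ = N := by field_simp; ring

/-- Factor `N / a` as `16 ^ t * (N / (16 ^ t * a))` and use `log 16 ≤ 3` and `log y ≤ y - 1`. The
entropy of a level set becomes linear in its size, and the remainder `N / 16 ^ t` stays summable
against the weight `4 ^ t` of level `t`. -/
lemma entropyWeight_le_level {N a : ℝ} (hN : 0 < N) (ha : 0 < a) (t : ℕ) :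
    entropyWeight N a ≤ a * (1 + 3 * t) + N / 16 ^ t := by
  have h16 : Real.log 16 ≤ 3 := by
    have : (16 : ℝ) = 2 ^ 4 := by norm_num
    rw [this, Real.log_pow]
    have := Real.log_two_lt_d9
    push_cast; linarith
  have h1 : Real.log (N / a) = t * Real.log 16 + Real.log (N / 16 ^ t / a) := by
    rw [← Real.log_pow, ← Real.log_mul (by positivity) (by positivity)]
    congr 1; field_simp
  have h2 := Real.log_le_sub_one_of_pos (show 0 < N / 16 ^ t / a by positivity)
  calc entropyWeight N a ≤ a * (1 + (t * 3 + N / 16 ^ t / a)) := by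
        unfold entropyWeight; rw [h1]; gcongr; linarith
    _ = _ := by field_simp; ring

lemma sum_pow_filter_le {ρ X : ℝ} (hρ : 1 < ρ) (hX : 0 ≤ X) (F : Finset ℕ) :
    ∑ s ∈ F with ρ ^ s ≤ X, ρ ^ s ≤ ρ / (ρ - 1) * X := by
  have hρ' : 0 < ρ - 1 := by linarith
  rcases (F.filter fun s => ρ ^ s ≤ X).eq_empty_or_nonempty with h | h
  · rw [h, Finset.sum_empty]; positivity
  · set M := (F.filter fun s => ρ ^ s ≤ X).max' h
    have hM : ρ ^ M ≤ X := (Finset.mem_filter.1 (Finset.max'_mem _ h)).2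
    have hsub : (F.filter fun s => ρ ^ s ≤ X) ⊆ Finset.range (M + 1) := fun s hs =>
      Finset.mem_range.2 (Nat.lt_succ_of_le (Finset.le_max' _ s hs))
    calc ∑ s ∈ F with ρ ^ s ≤ X, ρ ^ s ≤ ∑ s ∈ Finset.range (M + 1), ρ ^ s :=
          Finset.sum_le_sum_of_subset_of_nonneg hsub fun _ _ _ => by positivity
      _ = (ρ ^ (M + 1) - 1) / (ρ - 1) := geom_sum_eq hρ.ne' _
      _ ≤ (ρ * X) / (ρ - 1) := by
          gcongr
          rw [pow_succ']
          nlinarith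
      _ = _ := by ring

lemma sum_two_pow_filter_le {X : ℝ} (hX : 0 ≤ X) (F : Finset ℕ) :
    ∑ s ∈ F with (2 : ℝ) ^ s ≤ X, (2 : ℝ) ^ s ≤ 2 * X := by
  simpa using (sum_pow_filter_le (ρ := 2) (by norm_num) hX F).trans_eq (by norm_num)

lemma sum_sqrt_two_pow_filter_le {X : ℝ} (hX : 0 ≤ X) (F : Finset ℕ) :
    ∑ s ∈ F with (2 : ℝ) ^ s ≤ X, √(2 ^ s) ≤ 4 * √X := by
  have h1 : (1.4 : ℝ) < √2 := by
    rw [Real.lt_sqrt] <;> norm_num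
  have key : ∀ s : ℕ, √((2 : ℝ) ^ s) = √2 ^ s := fun s => by
    rw [Real.sqrt_eq_iff_mul_self_eq (by positivity) (by positivity), ← mul_pow]; simp
  have h := sum_pow_filter_le (ρ := √2) (by linarith) (Real.sqrt_nonneg X) F
  have hf : (F.filter fun s => (2 : ℝ) ^ s ≤ X) = F.filter fun s => √2 ^ s ≤ √X := by
    refine Finset.filter_congr fun s _ => ?_
    rw [← key, Real.sqrt_le_sqrt_iff hX]
  rw [hf]
  simp_rw [key]
  refine h.trans ?_
  gcongr
  rw [div_le_iff₀ (by linarith)]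
  linarith

/-- The exponent used in the Chernoff bound for level sets whose levels add up to `m`. -/
def levelExponent (D : ℝ) (m : ℕ) : ℝ := 1 + Real.log (4 * 2 ^ m / D)

/-- Two levels are balanced if neither value dominates the other by a factor `D`, while
the product of the values may exceed `D`. -/
def Balanced (D : ℝ) (s t : ℕ) : Prop :=
  (2 : ℝ) ^ s ≤ D * 2 ^ t ∧ (2 : ℝ) ^ t ≤ D * 2 ^ s ∧ D < 4 * 2 ^ (s + t)

lemma Balanced.symm {D : ℝ} {s t : ℕ} (h : Balanced D s t) : Balanced D t s :=
  ⟨h.2.1, h.1, by rw [add_comm]; exact h.2.2⟩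

lemma Balanced.one_le {D : ℝ} (hD : 0 < D) {s t : ℕ} (h : Balanced D s t) :
    1 ≤ levelExponent D (s + t) := by
  have := Real.log_nonneg ((one_le_div hD).2 h.2.2.le)
  unfold levelExponent; linarith

/-- The exponent is chosen for this identity: in the Chernoff bound it supplies a second factor `2 ^
(s + t)`, so that the main term carries the squared values `4 ^ s` and `4 ^ t`. -/
lemma exp_levelExponent {D : ℝ} (hD : 0 < D) (m : ℕ) :
    Real.exp (levelExponent D m) = Real.exp 1 * (4 * 2 ^ m / D) := by
  rw [levelExponent, Real.exp_add, Real.exp_log (by positivity)]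

open Classical in
-- The exponent is at least 1, and balance cuts the geometric sum over `s` off at `2 ^ s ≤ D * 2 ^
-- t`.
lemma sum_balanced_le {D : ℝ} (hD : 0 < D) (F : Finset ℕ) (t : ℕ) :
    ∑ s ∈ F with Balanced D s t, 4 * 2 ^ s * 2 ^ t / levelExponent D (s + t) ≤ 8 * D * 4 ^ t := by
  calc ∑ s ∈ F with Balanced D s t, 4 * 2 ^ s * 2 ^ t / levelExponent D (s + t)
      ≤ ∑ s ∈ F with Balanced D s t, (4 * 2 ^ t) * (2 : ℝ) ^ s := by
        refine Finset.sum_le_sum fun s hs => ?_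
        have h1 := (Finset.mem_filter.1 hs).2.one_le hD
        rw [div_le_iff₀ (by linarith)]
        have : (0 : ℝ) < 4 * 2 ^ s * 2 ^ t := by positivity
        nlinarith
    _ ≤ ∑ s ∈ F with (2 : ℝ) ^ s ≤ D * 2 ^ t, (4 * 2 ^ t) * (2 : ℝ) ^ s := by
        refine Finset.sum_le_sum_of_subset_of_nonneg (fun s hs => ?_) fun _ _ _ => by positivity
        simp only [Finset.mem_filter] at hs ⊢
        exact ⟨hs.1, hs.2.1⟩
    _ ≤ (4 * 2 ^ t) * (2 * (D * 2 ^ t)) := by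
        rw [← Finset.mul_sum]
        gcongr
        exact sum_two_pow_filter_le (by positivity) F
    _ = _ := by
        rw [show (4 : ℝ) ^ t = 2 ^ t * 2 ^ t by rw [← mul_pow]; norm_num]; ring

/-- With `q = D * 2 ^ t / 2 ^ s ≥ 1` one has `4 ^ (t + 1) = (4 * 2 ^ (s + t) / D) * q`. So the
factor linear in `t` is paid for by the exponent and by `log q ≤ 2 * √q`. -/
lemma level_mul_le {D : ℝ} (hD : 0 < D) {s t : ℕ} (h : Balanced D s t) :
    (1 + 3 * t : ℝ) * √(2 ^ s) ≤ 9 * levelExponent D (s + t) * √(D * 2 ^ t) := by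
  have h1 := h.one_le hD
  set q : ℝ := D * 2 ^ t / 2 ^ s with hq
  have hq1 : 1 ≤ q := (one_le_div (by positivity)).2 h.1
  have hsq : √(D * 2 ^ t) = √q * √(2 ^ s) := by
    rw [← Real.sqrt_mul (by positivity), hq]; congr 1; field_simp
  have hsq1 : 1 ≤ √q := Real.one_le_sqrt.2 hq1
  have hlogq : Real.log q ≤ 2 * √q := by
    have h2 : Real.log q = 2 * Real.log √q := by
      rw [Real.log_sqrt (by positivity)]; ring
    have := Real.log_le_sub_one_of_pos (show 0 < √q by positivity)
    linarith
  have hlog : (t + 1) * Real.log 4 = levelExponent D (s + t) - 1 + Real.log q := by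
    have : (4 : ℝ) ^ (t + 1) = (4 * 2 ^ (s + t) / D) * q := by
      rw [hq, pow_add, pow_succ, show (4 : ℝ) ^ t = 2 ^ t * 2 ^ t by rw [← mul_pow]; norm_num]
      field_simp
      ring
    have h3 := congrArg Real.log this
    rw [Real.log_pow, Real.log_mul (by positivity) (by positivity)] at h3
    rw [levelExponent]
    push_cast at h3
    linarith
  have hlog4 : 1 ≤ Real.log 4 := by
    rw [show (4 : ℝ) = 2 ^ 2 by norm_num, Real.log_pow]
    have := Real.log_two_gt_d9
    push_cast; linarith
  have ht : (0 : ℝ) ≤ t := Nat.cast_nonneg t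
  have h4 : (1 + 3 * t : ℝ) ≤ 9 * levelExponent D (s + t) * √q := by
    nlinarith [mul_nonneg (sub_nonneg.2 h1) (sub_nonneg.2 hsq1)]
  rw [hsq, ← mul_assoc]
  gcongr

open Classical in
-- The exponent cancels the factor `1 + 3 * t` at the price of `√q`; what remains is a sum of `√(2 ^
-- s)`, still geometric, with the same cutoff.
lemma level_mul_sum_balanced_le {D : ℝ} (hD : 0 < D) (F : Finset ℕ) (t : ℕ) :
    (∑ s ∈ F with Balanced D s t, 4 * 2 ^ s * 2 ^ t / levelExponent D (s + t)) * (1 + 3 * t)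
      ≤ 144 * D * 4 ^ t := by
  calc (∑ s ∈ F with Balanced D s t, 4 * 2 ^ s * 2 ^ t / levelExponent D (s + t)) * (1 + 3 * t)
      ≤ ∑ s ∈ F with Balanced D s t, (36 * 2 ^ t * √(D * 2 ^ t)) * √(2 ^ s) := by
        rw [Finset.sum_mul]
        refine Finset.sum_le_sum fun s hs => ?_
        have hb := (Finset.mem_filter.1 hs).2
        have h1 := hb.one_le hD
        have h2 := level_mul_le hD hb
        have h3 : (2 : ℝ) ^ s = √(2 ^ s) * √(2 ^ s) := (Real.mul_self_sqrt (by positivity)).symm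
        rw [div_mul_eq_mul_div, div_le_iff₀ (by linarith)]
        calc 4 * 2 ^ s * 2 ^ t * (1 + 3 * t : ℝ)
            = 4 * √(2 ^ s) * 2 ^ t * ((1 + 3 * t) * √(2 ^ s)) := by
              nth_rewrite 1 [h3]; ring
          _ ≤ 4 * √(2 ^ s) * 2 ^ t * (9 * levelExponent D (s + t) * √(D * 2 ^ t)) := by gcongr
          _ = _ := by ring
    _ ≤ ∑ s ∈ F with (2 : ℝ) ^ s ≤ D * 2 ^ t, (36 * 2 ^ t * √(D * 2 ^ t)) * √(2 ^ s) := by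
        refine Finset.sum_le_sum_of_subset_of_nonneg (fun s hs => ?_) fun _ _ _ => by positivity
        simp only [Finset.mem_filter] at hs ⊢
        exact ⟨hs.1, hs.2.1⟩
    _ ≤ (36 * 2 ^ t * √(D * 2 ^ t)) * (4 * √(D * 2 ^ t)) := by
        rw [← Finset.mul_sum]
        gcongr
        exact sum_sqrt_two_pow_filter_le (by positivity) F
    _ = 144 * 2 ^ t * (√(D * 2 ^ t) * √(D * 2 ^ t)) := by ring
    _ = _ := by
        rw [Real.mul_self_sqrt (by positivity),
          show (4 : ℝ) ^ t = 2 ^ t * 2 ^ t by rw [← mul_pow]; norm_num]; ring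

variable {V : Type*} [Fintype V]

/-- The number of edges (with weights `T`) between two sets never exceeds its Chernoff bound with
exponent `θ`. -/
def Discrepancy (T : V → V → ℝ) (p θ : ℝ) : Prop :=
  ∀ A B : Finset V, A.Nonempty → B.Nonempty →
    (∑ i ∈ A, ∑ j ∈ B, T i j) * θ ≤ p * A.card * B.card * Real.exp θ +
      3 * entropyWeight (Fintype.card V) A.card + 3 * entropyWeight (Fintype.card V) B.card

/-- This is the discrepancy inequality divided by its exponent `θ ≥ 1`. The main term becomes a
product of the squared masses of the two levels; each entropy term keeps its `1 / θ`, which is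
needed later to absorb `1 + 3 * t`. -/
lemma level_term_le {T : V → V → ℝ} {p D : ℝ} (hD : 0 < D) (hp : 0 ≤ p) {s t : ℕ}
    (hb : Balanced D s t) (hT : Discrepancy T p (levelExponent D (s + t))) (A B : Finset V)
    (hA : A.Nonempty) (hB : B.Nonempty) :
    4 * 2 ^ s * 2 ^ t * (∑ i ∈ A, ∑ j ∈ B, T i j) ≤
      16 * Real.exp 1 * p / D * ((4 ^ s * A.card) * (4 ^ t * B.card)) +
      3 * (4 * 2 ^ s * 2 ^ t / levelExponent D (s + t) *
        (B.card * (1 + 3 * t) + Fintype.card V / 16 ^ t)) +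
      3 * (4 * 2 ^ t * 2 ^ s / levelExponent D (t + s) *
        (A.card * (1 + 3 * s) + Fintype.card V / 16 ^ s)) := by
  have h1 := hb.one_le hD
  have hA' : (0 : ℝ) < A.card := by exact_mod_cast hA.card_pos
  have hB' : (0 : ℝ) < B.card := by exact_mod_cast hB.card_pos
  have hN : (0 : ℝ) < Fintype.card V := by
    exact_mod_cast hA.card_pos.trans_le (Finset.card_le_univ A)
  have h := hT A B hA hB
  rw [exp_levelExponent hD] at h
  have hgA := entropyWeight_le_level hN hA' s
  have hgB := entropyWeight_le_level hN hB' t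
  rw [show levelExponent D (t + s) = levelExponent D (s + t) by rw [add_comm]]
  set θ := levelExponent D (s + t)
  set N : ℝ := (Fintype.card V : ℝ)
  have hθ : 0 < θ := by linarith
  set E := ∑ i ∈ A, ∑ j ∈ B, T i j
  have hE : E ≤ (p * A.card * B.card * (Real.exp 1 * (4 * 2 ^ (s + t) / D)) / θ +
      3 * ((B.card * (1 + 3 * t) + N / 16 ^ t) / θ) +
      3 * ((A.card * (1 + 3 * s) + N / 16 ^ s) / θ)) := by
    have hE' : E ≤ (p * A.card * B.card * (Real.exp 1 * (4 * 2 ^ (s + t) / D)) +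
        3 * (B.card * (1 + 3 * t) + N / 16 ^ t) + 3 * (A.card * (1 + 3 * s) + N / 16 ^ s)) / θ := by
      rw [le_div_iff₀ hθ]
      linarith
    exact hE'.trans_eq (by ring)
  have h4 : ∀ k : ℕ, (4 : ℝ) ^ k = 2 ^ k * 2 ^ k := fun k => by rw [← mul_pow]; norm_num
  calc 4 * 2 ^ s * 2 ^ t * E ≤ 4 * 2 ^ s * 2 ^ t * _ := mul_le_mul_of_nonneg_left hE (by positivity)
    _ = 16 * Real.exp 1 * p / D * ((4 ^ s * A.card) * (4 ^ t * B.card)) / θ +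
      3 * (4 * 2 ^ s * 2 ^ t / θ * (B.card * (1 + 3 * t) + N / 16 ^ t)) +
      3 * (4 * 2 ^ t * 2 ^ s / θ * (A.card * (1 + 3 * s) + N / 16 ^ s)) := by
        rw [h4, h4, pow_add]
        field_simp
        ring
    _ ≤ _ := by
        gcongr
        exact div_le_self (by positivity) h1

open Classical in
-- The part linear in `a t` costs `432 * 16`, by the hypothesis on the squared mass. In the
-- remainder `4 ^ t / 16 ^ t` is geometric and costs `24 * 2`.
lemma sum_levels_le {D N : ℝ} (hD : 0 < D) (hN : 0 ≤ N) (L : ℕ) (a : ℕ → ℝ) (ha : ∀ t, 0 ≤ a t)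
    (hsum : ∑ t ∈ Finset.range L, 4 ^ t * a t ≤ 16 * N) :
    ∑ t ∈ Finset.range L, ∑ s ∈ Finset.range L with Balanced D s t,
      3 * (4 * 2 ^ s * 2 ^ t / levelExponent D (s + t) * (a t * (1 + 3 * t) + N / 16 ^ t)) ≤
      6960 * D * N := by
  have hgeom : ∑ t ∈ Finset.range L, ((1 : ℝ) / 4) ^ t ≤ 2 := by
    rw [geom_sum_eq (by norm_num)]
    have : (0 : ℝ) < (1 / 4) ^ L := by positivity
    rw [div_le_iff_of_neg (by norm_num)]
    linarith
  calc _ ≤ ∑ t ∈ Finset.range L, (432 * D * (4 ^ t * a t) + 24 * D * N * (1 / 4) ^ t) := by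
        refine Finset.sum_le_sum fun t _ => ?_
        rw [← Finset.mul_sum, ← Finset.sum_mul]
        have h1 := level_mul_sum_balanced_le hD (Finset.range L) t
        have h2 := sum_balanced_le hD (Finset.range L) t
        set S := ∑ s ∈ Finset.range L with Balanced D s t,
          4 * 2 ^ s * 2 ^ t / levelExponent D (s + t)
        have h3 : (4 : ℝ) ^ t / 16 ^ t = (1 / 4) ^ t := by
          rw [← div_pow]; norm_num
        calc 3 * (S * (a t * (1 + 3 * t) + N / 16 ^ t))
            = 3 * (a t * (S * (1 + 3 * t)) + S * (N / 16 ^ t)) := by ring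
          _ ≤ 3 * (a t * (144 * D * 4 ^ t) + (8 * D * 4 ^ t) * (N / 16 ^ t)) := by
              have := ha t
              gcongr
          _ = 432 * D * (4 ^ t * a t) + 24 * D * N * (4 ^ t / 16 ^ t) := by ring
          _ = _ := by rw [h3]
    _ = 432 * D * ∑ t ∈ Finset.range L, 4 ^ t * a t +
          24 * D * N * ∑ t ∈ Finset.range L, ((1 : ℝ) / 4) ^ t := by
        rw [Finset.sum_add_distrib, Finset.mul_sum, Finset.mul_sum]
    _ ≤ 432 * D * (16 * N) + 24 * D * N * 2 := by gcongr
    _ = _ := by ring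

lemma sum_sum_mul_add_symm (L : ℕ) (f : ℕ → ℝ) (R : ℕ → ℕ → ℝ) (c : ℝ) :
    ∑ s ∈ Finset.range L, ∑ t ∈ Finset.range L, (c * (f s * f t) + R s t + R t s) =
      c * ((∑ s ∈ Finset.range L, f s) * ∑ s ∈ Finset.range L, f s) +
      (∑ t ∈ Finset.range L, ∑ s ∈ Finset.range L, R s t) +
      ∑ t ∈ Finset.range L, ∑ s ∈ Finset.range L, R s t := by
  simp only [Finset.sum_add_distrib]
  rw [Finset.sum_comm (f := fun s t => R s t), Finset.sum_mul_sum, Finset.mul_sum]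
  simp only [Finset.mul_sum]

lemma product_constant_le {p D N : ℝ} (hD : 0 < D) (hN : 0 ≤ N) (hpN : p * N = 2 * D ^ 2) :
    16 * Real.exp 1 * p / D * ((16 * N) * (16 * N)) ≤ 22300 * D * N := by
  have he : Real.exp 1 ≤ 2.72 := Real.exp_one_lt_d9.le.trans (by norm_num)
  calc 16 * Real.exp 1 * p / D * ((16 * N) * (16 * N))
      = 4096 * Real.exp 1 * N * ((p * N) / D) := by ring
    _ = 8192 * Real.exp 1 * (D * N) := by
        rw [hpN, show 2 * D ^ 2 / D = 2 * D by field_simp]; ring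
    _ ≤ 8192 * 2.72 * (D * N) := by gcongr
    _ ≤ _ := by nlinarith [mul_nonneg hD.le hN]

open Classical in
lemma sum_balanced_edges_le {T : V → V → ℝ} {p D : ℝ} (hD : 0 < D) (hp : 0 ≤ p)
    (hpN : p * Fintype.card V = 2 * D ^ 2) (S : Finset V) (l : V → ℕ)
    (hl : ∑ i ∈ S, (4 : ℝ) ^ l i ≤ 16 * Fintype.card V)
    (hT : ∀ m : ℕ, (2 : ℝ) ^ m ≤ 16 * Fintype.card V → Discrepancy T p (levelExponent D m)) :
    ∑ i ∈ S, ∑ j ∈ S, (if Balanced D (l i) (l j) then 4 * 2 ^ l i * 2 ^ l j * T i j else 0) ≤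
      40000 * D * Fintype.card V := by
  set N : ℝ := (Fintype.card V : ℝ) with hNdef
  have hN : 0 ≤ N := Nat.cast_nonneg _
  set L := S.sup l + 1
  set I : ℕ → Finset V := fun s => S.filter fun i => l i = s with hI
  have hmaps : ∀ i ∈ S, l i ∈ Finset.range L := fun i hi =>
    Finset.mem_range.2 (Nat.lt_succ_of_le (Finset.le_sup hi))
  have hsum : ∑ t ∈ Finset.range L, (4 : ℝ) ^ t * (I t).card ≤ 16 * N := by
    rw [← Finset.sum_fiberwise_of_maps_to hmaps] at hl
    refine le_trans (Finset.sum_le_sum fun t _ => ?_) hl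
    rw [Finset.sum_congr rfl (g := fun _ => (4 : ℝ) ^ t)
      (fun i hi => by rw [(Finset.mem_filter.1 hi).2]), Finset.sum_const, nsmul_eq_mul, mul_comm]
  have hpow : ∀ s, (I s).Nonempty → (4 : ℝ) ^ s ≤ 16 * N := by
    rintro s ⟨i, hi⟩
    obtain ⟨hiS, his⟩ := Finset.mem_filter.1 hi
    rw [← his]
    exact (Finset.single_le_sum (f := fun i => (4 : ℝ) ^ l i) (fun _ _ => by positivity)
      hiS).trans hl
  set Q : ℕ → ℕ → ℝ := fun s t => 3 * (4 * 2 ^ s * 2 ^ t / levelExponent D (s + t) *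
        ((I t).card * (1 + 3 * t) + N / 16 ^ t)) with hQ
  set c := 16 * Real.exp 1 * p / D with hc
  have hc0 : 0 ≤ c := by positivity
  have hterm : ∀ s t, (if Balanced D s t then
      4 * 2 ^ s * 2 ^ t * (∑ i ∈ I s, ∑ j ∈ I t, T i j) else 0) ≤
      c * ((4 ^ s * (I s).card) * (4 ^ t * (I t).card)) +
      (if Balanced D s t then Q s t else 0) + (if Balanced D t s then Q t s else 0) := by
    intro s t
    by_cases hb : Balanced D s t
    · rw [if_pos hb, if_pos hb, if_pos hb.symm]
      have h1 := hb.one_le hD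
      have h1' := hb.symm.one_le hD
      by_cases hne : (I s).Nonempty ∧ (I t).Nonempty
      · refine level_term_le hD hp hb (hT _ ?_) _ _ hne.1 hne.2
        have hs := hpow s hne.1
        have ht := hpow t hne.2
        have h4 : ∀ k : ℕ, (4 : ℝ) ^ k = 2 ^ k * 2 ^ k := fun k => by rw [← mul_pow]; norm_num
        rw [h4] at hs ht
        rw [pow_add]
        -- Nonempty levels have `4 ^ s, 4 ^ t ≤ 16 * N`, so `2 ^ (s + t) ≤ 16 * N` by AM-GM. Hence
        -- finitely many exponents suffice.
        nlinarith [sq_nonneg ((2 : ℝ) ^ s - 2 ^ t)]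
      · have h0 : ∑ i ∈ I s, ∑ j ∈ I t, T i j = 0 := by
          rw [not_and_or, Finset.not_nonempty_iff_eq_empty, Finset.not_nonempty_iff_eq_empty] at hne
          rcases hne with h | h
          · rw [h, Finset.sum_empty]
          · exact Finset.sum_eq_zero fun i _ => by rw [h, Finset.sum_empty]
        rw [h0, mul_zero]
        simp only [hQ]
        positivity
    · rw [if_neg hb, if_neg hb, if_neg fun h => hb h.symm]
      positivity
  have hQsum : ∑ t ∈ Finset.range L, ∑ s ∈ Finset.range L, (if Balanced D s t then Q s t else 0) ≤
      6960 * D * N := by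
    have := sum_levels_le hD hN L (fun t => ((I t).card : ℝ)) (fun _ => Nat.cast_nonneg _) hsum
    simpa only [Finset.sum_filter] using this
  calc _ = ∑ s ∈ Finset.range L, ∑ t ∈ Finset.range L, (if Balanced D s t then
        4 * 2 ^ s * 2 ^ t * (∑ i ∈ I s, ∑ j ∈ I t, T i j) else 0) := by
        rw [← Finset.sum_fiberwise_of_maps_to hmaps]
        refine Finset.sum_congr rfl fun s _ => ?_
        rw [Finset.sum_congr rfl (fun i _ => (Finset.sum_fiberwise_of_maps_to hmaps _).symm),
          Finset.sum_comm]
        refine Finset.sum_congr rfl fun t _ => ?_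
        split_ifs with hb
        · rw [Finset.mul_sum]
          refine Finset.sum_congr rfl fun i hi => ?_
          rw [Finset.mul_sum]
          refine Finset.sum_congr rfl fun j hj => ?_
          rw [(Finset.mem_filter.1 hi).2, (Finset.mem_filter.1 hj).2, if_pos hb]
        · refine Finset.sum_eq_zero fun i hi => Finset.sum_eq_zero fun j hj => ?_
          rw [(Finset.mem_filter.1 hi).2, (Finset.mem_filter.1 hj).2, if_neg hb]
    _ ≤ ∑ s ∈ Finset.range L, ∑ t ∈ Finset.range L,
        (c * ((4 ^ s * (I s).card) * (4 ^ t * (I t).card)) +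
        (if Balanced D s t then Q s t else 0) + (if Balanced D t s then Q t s else 0)) :=
        Finset.sum_le_sum fun s _ => Finset.sum_le_sum fun t _ => hterm s t
    _ = c * ((∑ s ∈ Finset.range L, (4 : ℝ) ^ s * (I s).card) *
          (∑ s ∈ Finset.range L, (4 : ℝ) ^ s * (I s).card)) +
        (∑ t ∈ Finset.range L, ∑ s ∈ Finset.range L, (if Balanced D s t then Q s t else 0)) +
        ∑ t ∈ Finset.range L, ∑ s ∈ Finset.range L, (if Balanced D s t then Q s t else 0) := by
        exact sum_sum_mul_add_symm L _ (fun s t => if Balanced D s t then Q s t else 0) c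
    _ ≤ c * ((16 * N) * (16 * N)) + 6960 * D * N + 6960 * D * N := by
        have h0 : 0 ≤ ∑ s ∈ Finset.range L, (4 : ℝ) ^ s * (I s).card :=
          Finset.sum_nonneg fun _ _ => by positivity
        exact add_le_add (add_le_add (mul_le_mul_of_nonneg_left
          (mul_le_mul hsum hsum h0 (by positivity)) hc0) hQsum) hQsum
    _ ≤ 22300 * D * N + 6960 * D * N + 6960 * D * N := by
        exact add_le_add_left (add_le_add_left (product_constant_le hD hN hpN) _) _
    _ ≤ 40000 * D * N := by linarith [mul_nonneg hD.le hN]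

end

/-! ### Heavy pairs and the quadratic form of the trimmed matrix. -/

section

variable {V : Type*} [Fintype V]

lemma sum_sum_sq_mul_le {T : V → V → ℝ} {z : V → ℝ} {k S : ℝ}
    (hk : 0 ≤ k) (hz : ∑ i, z i ^ 2 ≤ S) (hT : ∀ i, z i ≠ 0 → ∑ j, T i j ≤ k) :
    ∑ i, ∑ j, z i ^ 2 * T i j ≤ k * S := by
  calc ∑ i, ∑ j, z i ^ 2 * T i j ≤ ∑ i, z i ^ 2 * k := by
        refine Finset.sum_le_sum fun i _ => ?_
        rw [← Finset.mul_sum]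
        rcases eq_or_ne (z i) 0 with h | h
        · simp [h]
        · exact mul_le_mul_of_nonneg_left (hT i h) (sq_nonneg _)
    _ = k * ∑ i, z i ^ 2 := by rw [← Finset.sum_mul, mul_comm]
    _ ≤ _ := by gcongr

lemma two_pow_log_le_abs {m : ℤ} (hm : m ≠ 0) : (2 : ℝ) ^ Nat.log 2 m.natAbs ≤ |(m : ℝ)| := by
  have := Nat.pow_log_le_self 2 (Int.natAbs_ne_zero.2 hm)
  rw [← Int.cast_abs, Int.abs_eq_natAbs]
  exact_mod_cast this

lemma abs_le_two_mul_two_pow_log (m : ℤ) : |(m : ℝ)| ≤ 2 * (2 : ℝ) ^ Nat.log 2 m.natAbs := by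
  have := (Nat.lt_pow_succ_log_self (b := 2) (by norm_num) m.natAbs).le
  rw [← Int.cast_abs, Int.abs_eq_natAbs, ← pow_succ']
  exact_mod_cast this

open Classical in
-- For a heavy pair of nonzero values with unbalanced levels, one value is at least `D / 2` times
-- the other, so the product is at most `2 / D` times a single square. Such pairs are charged to a
-- row or column sum, the others to the level sets.
lemma heavy_pair_le {D τ : ℝ} (hD : 0 < D) (hτ : 0 ≤ τ) (a b : ℤ) :
    (if D < |(a : ℝ)| * |(b : ℝ)| then |(a : ℝ)| * |(b : ℝ)| * τ else 0) ≤
      2 / D * ((a : ℝ) ^ 2 * τ) + 2 / D * ((b : ℝ) ^ 2 * τ) +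
      (if a ≠ 0 ∧ b ≠ 0 then
        if Balanced D (Nat.log 2 a.natAbs) (Nat.log 2 b.natAbs) then
          4 * 2 ^ Nat.log 2 a.natAbs * 2 ^ Nat.log 2 b.natAbs * τ else 0 else 0) := by
  split_ifs with h h0 hb <;> try positivity
  · have h1 := abs_le_two_mul_two_pow_log a
    have h2 := abs_le_two_mul_two_pow_log b
    have : |(a : ℝ)| * |(b : ℝ)| ≤ (2 * 2 ^ Nat.log 2 a.natAbs) * (2 * 2 ^ Nat.log 2 b.natAbs) := by
      gcongr
    have h3 : |(a : ℝ)| * |(b : ℝ)| * τ ≤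
      (2 * 2 ^ Nat.log 2 a.natAbs) * (2 * 2 ^ Nat.log 2 b.natAbs) * τ := by gcongr
    have h4 : 0 ≤ 2 / D * ((a : ℝ) ^ 2 * τ) := by positivity
    have h5 : 0 ≤ 2 / D * ((b : ℝ) ^ 2 * τ) := by positivity
    linarith
  · have h1 := abs_le_two_mul_two_pow_log a
    have h2 := abs_le_two_mul_two_pow_log b
    have h3 := two_pow_log_le_abs h0.1
    have h4 := two_pow_log_le_abs h0.2
    have key : ∀ u v : ℝ, 0 ≤ u → 0 ≤ v → D * v ≤ 2 * u → u * v * τ ≤ 2 / D * (u ^ 2 * τ) := by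
      intro u v hu hv h
      have : v ≤ 2 * u / D := by rw [le_div_iff₀ hD]; linarith
      calc u * v * τ ≤ u * (2 * u / D) * τ := by gcongr
        _ = _ := by ring
    have hprod : D < 4 * 2 ^ (Nat.log 2 a.natAbs + Nat.log 2 b.natAbs) := by
      calc D < |(a : ℝ)| * |(b : ℝ)| := h
        _ ≤ (2 * 2 ^ Nat.log 2 a.natAbs) * (2 * 2 ^ Nat.log 2 b.natAbs) := by gcongr
        _ = _ := by rw [pow_add]; ring
    rw [← sq_abs (a : ℝ), ← sq_abs (b : ℝ), add_zero]
    by_cases hs : (2 : ℝ) ^ Nat.log 2 a.natAbs ≤ D * 2 ^ Nat.log 2 b.natAbs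
    · have ht : ¬ (2 : ℝ) ^ Nat.log 2 b.natAbs ≤ D * 2 ^ Nat.log 2 a.natAbs := fun ht =>
        hb ⟨hs, ht, hprod⟩
      have := key |(b : ℝ)| |(a : ℝ)| (abs_nonneg _) (abs_nonneg _) (by
        push Not at ht
        nlinarith [mul_le_mul_of_nonneg_left h1 hD.le])
      have h5 : 0 ≤ 2 / D * (|(a : ℝ)| ^ 2 * τ) := by positivity
      rw [mul_comm |(a : ℝ)|]
      linarith
    · have := key |(a : ℝ)| |(b : ℝ)| (abs_nonneg _) (abs_nonneg _) (by
        push Not at hs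
        nlinarith [mul_le_mul_of_nonneg_left h2 hD.le])
      have h5 : 0 ≤ 2 / D * (|(b : ℝ)| ^ 2 * τ) := by positivity
      linarith
  · rw [not_and_or, not_not, not_not] at h0
    exfalso
    rcases h0 with h0 | h0 <;> simp [h0] at h <;> linarith

open Classical in
-- The unbalanced pairs cost `2 / D * (20 * D ^ 2) * (16 * N) = 640 * D * N` for rows and as much
-- for columns. This is where bounded degrees are indispensable.
lemma sum_heavy_le {T : V → V → ℝ} (hT0 : ∀ i j, 0 ≤ T i j) {p D : ℝ} (hD : 0 < D) (hp : 0 ≤ p)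
    (hpN : p * Fintype.card V = 2 * D ^ 2) (z : V → ℤ)
    (hz : ∑ i, (z i : ℝ) ^ 2 ≤ 16 * Fintype.card V)
    (hrow : ∀ i, z i ≠ 0 → ∑ j, T i j ≤ 20 * D ^ 2)
    (hcol : ∀ j, z j ≠ 0 → ∑ i, T i j ≤ 20 * D ^ 2)
    (hT : ∀ m : ℕ, (2 : ℝ) ^ m ≤ 16 * Fintype.card V → Discrepancy T p (levelExponent D m)) :
    ∑ i, ∑ j, (if D < |(z i : ℝ)| * |(z j : ℝ)| then |(z i : ℝ)| * |(z j : ℝ)| * T i j else 0) ≤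
      41280 * D * Fintype.card V := by
  have h1 : ∑ i, ∑ j, (z i : ℝ) ^ 2 * T i j ≤ 20 * D ^ 2 * (16 * Fintype.card V) :=
    sum_sum_sq_mul_le (by positivity) hz fun i hi => hrow i (by exact_mod_cast hi)
  have h2 : ∑ i, ∑ j, (z j : ℝ) ^ 2 * T i j ≤ 20 * D ^ 2 * (16 * Fintype.card V) := by
    rw [Finset.sum_comm]
    exact sum_sum_sq_mul_le (T := fun i j => T j i) (by positivity) hz
      fun i hi => hcol i (by exact_mod_cast hi)
  have h3 := sum_balanced_edges_le (T := T) hD hp hpN (Finset.univ.filter fun i => z i ≠ 0)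
    (fun i => Nat.log 2 (z i).natAbs) (by
      refine le_trans ?_ hz
      rw [Finset.sum_filter]
      refine Finset.sum_le_sum fun i _ => ?_
      split_ifs with h
      · rw [← sq_abs (z i : ℝ), show (4 : ℝ) = 2 ^ 2 by norm_num, ← pow_mul, mul_comm 2, pow_mul]
        have := two_pow_log_le_abs h
        gcongr
      · positivity) hT
  calc _ ≤ ∑ i, ∑ j, (2 / D * ((z i : ℝ) ^ 2 * T i j) + 2 / D * ((z j : ℝ) ^ 2 * T i j) +
      (if z i ≠ 0 ∧ z j ≠ 0 then
        if Balanced D (Nat.log 2 (z i).natAbs) (Nat.log 2 (z j).natAbs) then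
          4 * 2 ^ Nat.log 2 (z i).natAbs * 2 ^ Nat.log 2 (z j).natAbs * T i j else 0 else 0)) :=
        Finset.sum_le_sum fun i _ => Finset.sum_le_sum fun j _ => heavy_pair_le hD (hT0 i j) _ _
    _ ≤ 2 / D * (20 * D ^ 2 * (16 * Fintype.card V)) + 2 / D * (20 * D ^ 2 * (16 * Fintype.card V))
        + 40000 * D * Fintype.card V := by
        simp only [Finset.sum_add_distrib]
        refine add_le_add (add_le_add ?_ ?_) (le_trans (le_of_eq ?_) h3)
        · refine le_trans (le_of_eq ?_) (mul_le_mul_of_nonneg_left h1 (by positivity))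
          simp only [Finset.mul_sum]
        · refine le_trans (le_of_eq ?_) (mul_le_mul_of_nonneg_left h2 (by positivity))
          simp only [Finset.mul_sum]
        rw [Finset.sum_filter]
        refine Finset.sum_congr rfl fun i _ => ?_
        by_cases hi : z i = 0
        · simp [hi]
        · simp [hi, Finset.sum_filter]
    _ = _ := by field_simp; ring

/-- The quadratic form of `T - t` is of order `D` times the squared length of `z`, for the pairs
`i, j` with `|z i * z j| ≤ D`. -/
def LightBound (T t : V → V → ℝ) (D : ℝ) : Prop :=
  ∀ z : V → ℤ, ∑ i, (z i : ℝ) ^ 2 ≤ 16 * Fintype.card V →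
    |∑ i, ∑ j, (if |(z i : ℝ)| * |(z j : ℝ)| ≤ D then (z i : ℝ) * z j * (T i j - t i j) else 0)| ≤
      540 * D * Fintype.card V

lemma abs_sum_sum_le {f g : V → V → ℝ} (h : ∀ i j, |f i j| ≤ g i j) :
    |∑ i, ∑ j, f i j| ≤ ∑ i, ∑ j, g i j :=
  (Finset.abs_sum_le_sum_abs _ _).trans <| Finset.sum_le_sum fun i _ =>
    (Finset.abs_sum_le_sum_abs _ _).trans <| Finset.sum_le_sum fun j _ => h i j

/-- Light pairs are treated with their mean subtracted. On heavy pairs `T` and `t` are bounded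
separately, the mean through `|z i * z j| ≤ (z i * z j) ^ 2 / D`, which gives `p / D * (16 * N) ^ 2
= 512 * D * N`. -/
theorem abs_quadratic_form_le {T t : V → V → ℝ} (hT0 : ∀ i j, 0 ≤ T i j) {p D : ℝ} (hD : 0 < D)
    (hp : 0 ≤ p) (ht0 : ∀ i j, 0 ≤ t i j) (htp : ∀ i j, t i j ≤ p)
    (hpN : p * Fintype.card V = 2 * D ^ 2) (z : V → ℤ)
    (hz : ∑ i, (z i : ℝ) ^ 2 ≤ 16 * Fintype.card V)
    (hrow : ∀ i, z i ≠ 0 → ∑ j, T i j ≤ 20 * D ^ 2)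
    (hcol : ∀ j, z j ≠ 0 → ∑ i, T i j ≤ 20 * D ^ 2)
    (hT : ∀ m : ℕ, (2 : ℝ) ^ m ≤ 16 * Fintype.card V → Discrepancy T p (levelExponent D m))
    (hL : LightBound T t D) :
    |∑ i, ∑ j, (z i : ℝ) * z j * (T i j - t i j)| ≤ 42400 * D * Fintype.card V := by
  classical
  set N : ℝ := (Fintype.card V : ℝ)
  have hN : 0 ≤ N := Nat.cast_nonneg _
  have h1 := hL z hz
  have h2 := sum_heavy_le hT0 hD hp hpN z hz hrow hcol hT
  have h3 : ∑ i, ∑ j, (if D < |(z i : ℝ)| * |(z j : ℝ)| then |(z i : ℝ)| * |(z j : ℝ)| * t i j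
      else 0) ≤ 512 * D * N := by
    calc _ ≤ ∑ i, ∑ j, p / D * ((z i : ℝ) ^ 2 * (z j : ℝ) ^ 2) := by
          refine Finset.sum_le_sum fun i _ => Finset.sum_le_sum fun j _ => ?_
          split_ifs with h
          · have h0 : 0 ≤ |(z i : ℝ)| * |(z j : ℝ)| := by positivity
            calc |(z i : ℝ)| * |(z j : ℝ)| * t i j ≤ |(z i : ℝ)| * |(z j : ℝ)| * p := by
                  gcongr; exact htp i j
              _ ≤ |(z i : ℝ)| * |(z j : ℝ)| * p * (|(z i : ℝ)| * |(z j : ℝ)| / D) :=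
                  le_mul_of_one_le_right (by positivity) ((one_le_div hD).2 h.le)
              _ = p / D * (|(z i : ℝ)| ^ 2 * |(z j : ℝ)| ^ 2) := by ring
              _ = _ := by rw [sq_abs, sq_abs]
          · positivity
      _ = p / D * ((∑ i, (z i : ℝ) ^ 2) * ∑ i, (z i : ℝ) ^ 2) := by
          simp only [← Finset.mul_sum, Finset.sum_mul_sum]
      _ ≤ p / D * ((16 * N) * (16 * N)) := by gcongr
      _ = (p * N) / D * 256 * N := by ring
      _ = _ := by rw [hpN]; field_simp; ring
  have hsplit : ∑ i, ∑ j, (z i : ℝ) * z j * (T i j - t i j) =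
      (∑ i, ∑ j, (if |(z i : ℝ)| * |(z j : ℝ)| ≤ D then (z i : ℝ) * z j * (T i j - t i j) else 0)) +
      ∑ i, ∑ j, (if D < |(z i : ℝ)| * |(z j : ℝ)| then (z i : ℝ) * z j * (T i j - t i j) else 0) := by
    simp only [← Finset.sum_add_distrib]
    refine Finset.sum_congr rfl fun i _ => Finset.sum_congr rfl fun j _ => ?_
    by_cases h : |(z i : ℝ)| * |(z j : ℝ)| ≤ D
    · rw [if_pos h, if_neg (not_lt.2 h), add_zero]
    · rw [if_neg h, if_pos (not_le.1 h), zero_add]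
  have h4 : |∑ i, ∑ j, (if D < |(z i : ℝ)| * |(z j : ℝ)| then
      (z i : ℝ) * z j * (T i j - t i j) else 0)| ≤ 41280 * D * N + 512 * D * N := by
    refine (abs_sum_sum_le (g := fun i j =>
      (if D < |(z i : ℝ)| * |(z j : ℝ)| then |(z i : ℝ)| * |(z j : ℝ)| * T i j else 0) +
      (if D < |(z i : ℝ)| * |(z j : ℝ)| then |(z i : ℝ)| * |(z j : ℝ)| * t i j else 0))
      fun i j => ?_).trans ?_
    · split_ifs
      · rw [abs_mul, abs_mul, ← mul_add]
        gcongr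
        exact (abs_sub _ _).trans_eq (by rw [abs_of_nonneg (hT0 i j), abs_of_nonneg (ht0 i j)])
      · simp
    · simp only [Finset.sum_add_distrib]
      exact add_le_add h2 h3
  rw [hsplit]
  refine (abs_add_le _ _).trans ?_
  linarith [mul_nonneg hD.le hN]

open Classical in
-- Let `R` be the set of high-degree vertices. Discrepancy with exponent 1 for `(R, V)` and `(V, R)`
-- gives `20 * D ^ 2 * |R| ≤ 4 * e * D ^ 2 * |R| + 12 * N`, and `20 - 4 * e > 9`.
lemma card_trimmed_le {T : V → V → ℝ} {p D : ℝ} (hD : 0 < D)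
    (hpN : p * Fintype.card V = 2 * D ^ 2) (hT : Discrepancy T p 1) :
    D ^ 2 * (Finset.univ.filter fun i => 20 * D ^ 2 < ∑ j, (T i j + T j i)).card ≤
      2 * Fintype.card V := by
  set R := Finset.univ.filter fun i => 20 * D ^ 2 < ∑ j, (T i j + T j i)
  rcases R.eq_empty_or_nonempty with h | h
  · rw [h]; simp
  have hR : (0 : ℝ) < R.card := by exact_mod_cast h.card_pos
  have hne : (Finset.univ : Finset V).Nonempty := h.mono (Finset.subset_univ _)
  have hN : (0 : ℝ) < Fintype.card V := by
    exact_mod_cast h.card_pos.trans_le (Finset.card_le_univ R)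
  have h1 := hT R Finset.univ h hne
  have h2 := hT Finset.univ R hne h
  rw [Finset.card_univ] at h1 h2
  have h3 := entropyWeight_le hN hR
  have h4 := entropyWeight_le hN hN
  set N : ℝ := (Fintype.card V : ℝ)
  have h5 : (R.card : ℝ) * (20 * D ^ 2) ≤ ∑ i ∈ R, ∑ j, (T i j + T j i) := by
    rw [← nsmul_eq_mul]
    exact Finset.card_nsmul_le_sum _ _ _ fun i hi => (Finset.mem_filter.1 hi).2.le
  have h6 : ∑ i ∈ R, ∑ j, (T i j + T j i) = ∑ i ∈ R, ∑ j, T i j + ∑ i, ∑ j ∈ R, T i j := by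
    simp only [Finset.sum_add_distrib]
    rw [Finset.sum_comm (s := Finset.univ) (t := R)]
  have he : Real.exp 1 ≤ 2.72 := Real.exp_one_lt_d9.le.trans (by norm_num)
  have h7 : p * R.card * N * Real.exp 1 = 2 * (D ^ 2 * R.card) * Real.exp 1 := by
    linear_combination (R.card * Real.exp 1) * hpN
  have h8 : p * N * R.card * Real.exp 1 = 2 * (D ^ 2 * R.card) * Real.exp 1 := by
    linear_combination (R.card * Real.exp 1) * hpN
  rw [h7] at h1
  rw [h8] at h2
  have h9 : D ^ 2 * R.card * Real.exp 1 ≤ D ^ 2 * R.card * 2.72 := by gcongr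
  nlinarith

/-- Trimming moves from the matrix to the vector, which remains integral and gets no longer, so the
estimate for integer vectors still applies. -/
lemma trim_sum_eq {Y : Matrix V V ℝ} {k : ℝ} (z : V → ℤ) (i j : V) :
    (z i : ℝ) * z j * trim Y k i j =
      (open Classical in ((if k < degree Y i then 0 else z i : ℤ) : ℝ) *
        ((if k < degree Y j then 0 else z j : ℤ) : ℝ) * Y i j) := by
  by_cases hi : k < degree Y i <;> by_cases hj : k < degree Y j <;> simp [trim, hi, hj]

/-- The quadratic form of the trimmed matrix is close to that of the mean matrix `P`. -/
theorem abs_trim_quadratic_form_le {T t : V → V → ℝ} {Y P : Matrix V V ℝ}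
    (hY : ∀ i j, Y i j = T i j + T j i) (hT0 : ∀ i j, 0 ≤ T i j) {p D : ℝ} (hD : 0 < D)
    (hp : 0 ≤ p) (hpD : p ≤ D) (ht0 : ∀ i j, 0 ≤ t i j) (htp : ∀ i j, t i j ≤ p)
    (hP0 : ∀ i j, 0 ≤ P i j) (hPp : ∀ i j, P i j ≤ p)
    (hPt : ∀ i j, i ≠ j → P i j = t i j + t j i) (htd : ∀ i, t i i = 0)
    (hpN : p * Fintype.card V = 2 * D ^ 2) (hT1 : Discrepancy T p 1)
    (hT : ∀ m : ℕ, (2 : ℝ) ^ m ≤ 16 * Fintype.card V → Discrepancy T p (levelExponent D m))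
    (hL : LightBound T t D) (z : V → ℤ) (hz : ∑ i, (z i : ℝ) ^ 2 ≤ 16 * Fintype.card V) :
    |∑ i, ∑ j, (z i : ℝ) * z j * (trim Y (20 * D ^ 2) i j - P i j)| ≤
      85000 * D * Fintype.card V := by
  classical
  set N : ℝ := (Fintype.card V : ℝ) with hNdef
  have hN : 0 ≤ N := Nat.cast_nonneg _
  set w : V → ℤ := fun i => if 20 * D ^ 2 < degree Y i then 0 else z i with hw
  have hdeg : ∀ i, degree Y i = ∑ j, T i j + ∑ j, T j i := fun i => by
    rw [degree, ← Finset.sum_add_distrib]; exact Finset.sum_congr rfl fun j _ => hY i j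
  have hwz : ∀ i, (w i : ℝ) ^ 2 ≤ (z i : ℝ) ^ 2 := fun i => by
    simp only [hw]; split_ifs
    · simpa using sq_nonneg (z i : ℝ)
    · exact le_rfl
  have hw2 : ∑ i, (w i : ℝ) ^ 2 ≤ 16 * N := (Finset.sum_le_sum fun i _ => hwz i).trans hz
  have hwdeg : ∀ i, w i ≠ 0 → degree Y i ≤ 20 * D ^ 2 := fun i hi => by
    by_contra h
    exact hi (if_pos (not_le.1 h))
  have h1 := abs_quadratic_form_le hT0 hD hp ht0 htp hpN w hw2
    (fun i hi => by
      have := hwdeg i hi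
      rw [hdeg] at this
      have h0 : 0 ≤ ∑ j, T j i := Finset.sum_nonneg fun j _ => hT0 j i
      linarith)
    (fun i hi => by
      have := hwdeg i hi
      rw [hdeg] at this
      have h0 : 0 ≤ ∑ j, T i j := Finset.sum_nonneg fun j _ => hT0 i j
      linarith) hT hL
  set R := Finset.univ.filter fun i => 20 * D ^ 2 < ∑ j, (T i j + T j i) with hR
  have hcard := card_trimmed_le hD hpN hT1
  have hRmem : ∀ i, i ∈ R ↔ 20 * D ^ 2 < degree Y i := fun i => by
    rw [hdeg, ← Finset.sum_add_distrib, hR]; simp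
  -- Cauchy–Schwarz with `D ^ 2 * |R| ≤ 2 * N` gives `√32 * N / D`.
  have hRsum : ∑ i ∈ R, |(z i : ℝ)| ≤ 6 * N / D := by
    have h2 := sq_sum_le_card_mul_sum_sq (s := R) (f := fun i => |(z i : ℝ)|)
    simp only [sq_abs] at h2
    have h3 : ∑ i ∈ R, (z i : ℝ) ^ 2 ≤ 16 * N :=
      (Finset.sum_le_sum_of_subset_of_nonneg (Finset.subset_univ _)
        fun _ _ _ => sq_nonneg _).trans hz
    rw [le_div_iff₀ hD]
    refine abs_le_of_sq_le_sq' ?_ (by positivity) |>.2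
    calc ((∑ i ∈ R, |(z i : ℝ)|) * D) ^ 2 = (∑ i ∈ R, |(z i : ℝ)|) ^ 2 * D ^ 2 := by ring
      _ ≤ (R.card * ∑ i ∈ R, (z i : ℝ) ^ 2) * D ^ 2 := by gcongr
      _ ≤ (R.card * (16 * N)) * D ^ 2 := by gcongr
      _ = (D ^ 2 * R.card) * (16 * N) := by ring
      _ ≤ (2 * N) * (16 * N) := by gcongr
      _ ≤ _ := by nlinarith
  have hzsum : ∑ i, |(z i : ℝ)| ≤ 4 * N := by
    have h2 := sq_sum_le_card_mul_sum_sq (s := Finset.univ) (f := fun i => |(z i : ℝ)|)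
    simp only [sq_abs, Finset.card_univ] at h2
    refine abs_le_of_sq_le_sq' ?_ (by positivity) |>.2
    calc (∑ i, |(z i : ℝ)|) ^ 2 ≤ N * ∑ i, (z i : ℝ) ^ 2 := h2
      _ ≤ N * (16 * N) := by gcongr
      _ = _ := by ring
  -- Three errors: the centred form at the truncated vector `w`, counted for both triangles; the
  -- diagonal of `P`, absent from `t`; and the mean on pairs meeting a trimmed vertex, small because
  -- `R` carries little mass.
  have hsplit : ∑ i, ∑ j, (z i : ℝ) * z j * (trim Y (20 * D ^ 2) i j - P i j) =
      2 * (∑ i, ∑ j, (w i : ℝ) * w j * (T i j - t i j)) -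
      (∑ i, ∑ j, (w i : ℝ) * w j * (P i j - t i j - t j i)) -
      ∑ i, ∑ j, ((z i : ℝ) * z j - w i * w j) * P i j := by
    have hsw : ∑ i, ∑ j, (w i : ℝ) * w j * (T j i - t j i) =
        ∑ i, ∑ j, (w i : ℝ) * w j * (T i j - t i j) := by
      rw [Finset.sum_comm]
      exact Finset.sum_congr rfl fun i _ => Finset.sum_congr rfl fun j _ => by ring
    rw [two_mul]
    nth_rewrite 2 [← hsw]
    simp only [← Finset.sum_add_distrib, ← Finset.sum_sub_distrib]
    refine Finset.sum_congr rfl fun i _ => Finset.sum_congr rfl fun j _ => ?_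
    rw [mul_sub, trim_sum_eq, hY]
    simp only [hw]
    ring
  have h2 : |∑ i, ∑ j, (w i : ℝ) * w j * (P i j - t i j - t j i)| ≤ 16 * D * N := by
    refine (abs_sum_sum_le (g := fun i j => if i = j then (w i : ℝ) ^ 2 * D else 0)
      fun i j => ?_).trans ?_
    · split_ifs with h
      · subst h
        rw [htd, sub_zero, sub_zero, abs_mul, ← sq, abs_of_nonneg (sq_nonneg (w i : ℝ)),
          abs_of_nonneg (hP0 i i)]
        have := (hPp i i).trans hpD
        gcongr
      · rw [hPt i j h]; simp
    · simp only [Finset.sum_ite_eq, Finset.mem_univ, if_true]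
      rw [← Finset.sum_mul]
      calc (∑ i, (w i : ℝ) ^ 2) * D ≤ 16 * N * D := by gcongr
        _ = _ := by ring
  have h3 : |∑ i, ∑ j, ((z i : ℝ) * z j - w i * w j) * P i j| ≤ 96 * D * N := by
    refine (abs_sum_sum_le (g := fun i j =>
      p * ((if i ∈ R then |(z i : ℝ)| else 0) * |(z j : ℝ)|) +
      p * (|(z i : ℝ)| * (if j ∈ R then |(z j : ℝ)| else 0))) fun i j => ?_).trans ?_
    · rw [abs_mul, abs_of_nonneg (hP0 i j), ← mul_add, mul_comm p]
      refine mul_le_mul ?_ (hPp i j) (hP0 i j) (by positivity)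
      by_cases hi : i ∈ R <;> by_cases hj : j ∈ R <;>
        simp only [hi, hj, hw, ← hRmem, if_true, if_false] <;>
        simp [abs_mul, mul_nonneg, abs_nonneg]
    · simp only [Finset.sum_add_distrib, ← Finset.mul_sum, ← Finset.sum_mul]
      have h4 : ∑ i, (if i ∈ R then |(z i : ℝ)| else 0) ≤ 6 * N / D := by
        rw [← Finset.sum_filter, Finset.filter_univ_mem]
        exact hRsum
      have h5 : 0 ≤ ∑ i, (if i ∈ R then |(z i : ℝ)| else 0) :=
        Finset.sum_nonneg fun i _ => by positivity
      have h6 : (∑ i, (if i ∈ R then |(z i : ℝ)| else 0)) * ∑ i, |(z i : ℝ)| ≤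
          6 * N / D * (4 * N) := mul_le_mul h4 hzsum (by positivity) (by positivity)
      rw [mul_comm (∑ i, |(z i : ℝ)|)]
      calc _ ≤ p * (6 * N / D * (4 * N)) + p * (6 * N / D * (4 * N)) := by gcongr
        _ = 48 * (p * N) / D * N := by ring
        _ = _ := by rw [hpN]; field_simp; ring
  rw [hsplit]
  refine (abs_sub _ _).trans (le_trans (add_le_add (abs_sub _ _) le_rfl) ?_)
  rw [abs_mul, abs_two]
  linarith [mul_nonneg hD.le hN]

end

/-! ### Chernoff and union bounds. -/

section

variable {V : Type*} [Fintype V] {Ω : Type*} [MeasurableSpace Ω]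

/-- The exponential moments of linear combinations of the `T i j` are at most those of independent
Bernoulli variables with means `t i j`, in the form that Chernoff bounds use. -/
def ExpMomentBound (μ : Measure Ω) (T : Ω → V → V → ℝ) (t : V → V → ℝ) : Prop :=
  ∀ c : V → V → ℝ, Integrable (fun ω => Real.exp (∑ i, ∑ j, c i j * T ω i j)) μ ∧
    ∫ ω, Real.exp (∑ i, ∑ j, c i j * T ω i j) ∂μ ≤
      Real.exp (∑ i, ∑ j, t i j * (Real.exp (c i j) - 1))

lemma ExpMomentBound.chernoff {μ : Measure Ω} {T : Ω → V → V → ℝ} {t : V → V → ℝ}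
    (h : ExpMomentBound μ T t) (c : V → V → ℝ) (K : ℝ) :
    μ.real {ω | K ≤ ∑ i, ∑ j, c i j * T ω i j} ≤
      Real.exp (∑ i, ∑ j, t i j * (Real.exp (c i j) - 1) - K) := by
  have h1 := mul_meas_ge_le_integral_of_nonneg (μ := μ)
    (Eventually.of_forall fun ω => (Real.exp_pos (∑ i, ∑ j, c i j * T ω i j)).le) (h c).1
    (Real.exp K)
  simp only [Real.exp_le_exp] at h1
  rw [Real.exp_sub, le_div_iff₀ (Real.exp_pos K), mul_comm]
  exact h1.trans (h c).2

/-- One of the three copies of the entropy pays for the number of subsets; each of the other two is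
at least `log N`. -/
lemma choose_mul_exp_neg_entropyWeight_le {N a : ℕ} (ha : 0 < a) (haN : a ≤ N) :
    (N.choose a : ℝ) * Real.exp (-(3 * entropyWeight N a)) ≤ ((N : ℝ) ^ 2)⁻¹ := by
  have ha' : (0 : ℝ) < a := by exact_mod_cast ha
  have hN' : (0 : ℝ) < N := by exact_mod_cast ha.trans_le haN
  have haN' : (a : ℝ) ≤ N := by exact_mod_cast haN
  have h1 : (N.choose a : ℝ) ≤ Real.exp (entropyWeight N a) := by
    have hexp : Real.exp (entropyWeight N a) = Real.exp a * (N / a) ^ a := by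
      rw [entropyWeight, mul_add, mul_one, Real.exp_add, ← Real.log_pow, Real.exp_log (by positivity)]
    calc (N.choose a : ℝ) ≤ (N : ℝ) ^ a / a.factorial := Nat.choose_le_pow_div a N
      _ = ((a : ℝ) ^ a / a.factorial) * (N / a) ^ a := by rw [div_pow]; field_simp
      _ ≤ Real.exp a * (N / a) ^ a := by
          gcongr
          exact Real.pow_div_factorial_le_exp _ ha'.le _
      _ = _ := hexp.symm
  have h2 : Real.log N ≤ entropyWeight N a := by
    have h3 := Real.log_le_sub_one_of_pos ha'
    have h4 : Real.log a ≤ Real.log N := Real.log_le_log ha' haN'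
    have h5 : (1 : ℝ) ≤ a := by exact_mod_cast ha
    rw [entropyWeight, Real.log_div hN'.ne' ha'.ne']
    nlinarith [mul_nonneg (sub_nonneg.2 h5) (sub_nonneg.2 h4)]
  calc (N.choose a : ℝ) * Real.exp (-(3 * entropyWeight N a))
      ≤ Real.exp (entropyWeight N a) * Real.exp (-(3 * entropyWeight N a)) := by gcongr
    _ = Real.exp (-(entropyWeight N a) + -(entropyWeight N a)) := by rw [← Real.exp_add]; ring_nf
    _ ≤ Real.exp (-(Real.log N) + -(Real.log N)) := by gcongr
    _ = _ := by rw [Real.exp_add, Real.exp_neg, Real.exp_log hN', ← mul_inv, sq]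

lemma sum_exp_neg_entropyWeight_le :
    ∑ A : Finset V with A.Nonempty, Real.exp (-(3 * entropyWeight (Fintype.card V) A.card)) ≤
      (Fintype.card V : ℝ)⁻¹ := by
  classical
  set N := Fintype.card V with hN
  have h := Finset.sum_powerset_apply_card (x := (Finset.univ : Finset V))
    (fun m => if m = 0 then (0 : ℝ) else Real.exp (-(3 * entropyWeight N m)))
  rw [Finset.powerset_univ, Finset.card_univ, ← hN, Finset.sum_range_succ'] at h
  calc _ = ∑ A : Finset V, (if A.card = 0 then (0 : ℝ) else
        Real.exp (-(3 * entropyWeight N A.card))) := by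
        rw [Finset.sum_filter]
        refine Finset.sum_congr rfl fun A _ => ?_
        by_cases hA : A.Nonempty
        · rw [if_pos hA, if_neg hA.card_pos.ne']
        · rw [if_neg hA, if_pos (by simpa using hA)]
    _ = _ := h
    _ ≤ ∑ m ∈ Finset.range N, ((N : ℝ) ^ 2)⁻¹ := by
        simp only [if_true, smul_zero, add_zero]
        refine Finset.sum_le_sum fun m hm => ?_
        rw [if_neg m.succ_ne_zero, nsmul_eq_mul]
        exact choose_mul_exp_neg_entropyWeight_le m.succ_pos (Finset.mem_range.1 hm)
    _ = _ := by
        rw [Finset.sum_const, Finset.card_range, nsmul_eq_mul]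
        rcases Nat.eq_zero_or_pos N with h0 | h0
        · rw [h0]; simp
        · have : (N : ℝ) ≠ 0 := by positivity
          field_simp

/-- Apply Chernoff with coefficient `θ` on `A × B`. The two entropy terms make the failure
probability a product, so the union bound is the square of a sum over single sets, which is at most
`1 / N`. -/
theorem measure_not_discrepancy_le {μ : Measure Ω} [IsProbabilityMeasure μ]
    {T : Ω → V → V → ℝ} {t : V → V → ℝ} (h : ExpMomentBound μ T t) {p : ℝ}
    (ht0 : ∀ i j, 0 ≤ t i j) (htp : ∀ i j, t i j ≤ p) (θ : ℝ) :
    μ.real {ω | ¬ Discrepancy (T ω) p θ} ≤ ((Fintype.card V : ℝ) ^ 2)⁻¹ := by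
  classical
  set S : Finset (Finset V) := Finset.univ.filter fun A => A.Nonempty
  set w : Finset V → ℝ := fun A => 3 * entropyWeight (Fintype.card V) A.card with hw
  set E : Finset V → Finset V → Set Ω := fun A B =>
    {ω | p * A.card * B.card * Real.exp θ + w A + w B ≤
      ∑ i, ∑ j, (if i ∈ A ∧ j ∈ B then θ else 0) * T ω i j} with hE
  have hprob : ∀ A B, μ.real (E A B) ≤ Real.exp (-w A) * Real.exp (-w B) := by
    intro A B
    refine (h.chernoff _ _).trans ?_
    rw [← Real.exp_add, Real.exp_le_exp]
    have : ∑ i, ∑ j, t i j * (Real.exp (if i ∈ A ∧ j ∈ B then θ else 0) - 1) ≤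
        p * A.card * B.card * Real.exp θ := by
      calc _ ≤ ∑ i, ∑ j, (if i ∈ A then (if j ∈ B then p * Real.exp θ else 0) else 0) := by
            refine Finset.sum_le_sum fun i _ => Finset.sum_le_sum fun j _ => ?_
            by_cases hi : i ∈ A <;> by_cases hj : j ∈ B <;> simp [hi, hj]
            have := Real.exp_pos θ
            nlinarith [ht0 i j, mul_le_mul_of_nonneg_right (htp i j) this.le]
        _ = _ := by
            simp; ring
    linarith
  have hsub : {ω | ¬ Discrepancy (T ω) p θ} ⊆ ⋃ A ∈ S, ⋃ B ∈ S, E A B := by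
    intro ω hω
    simp only [Set.mem_ofPred_eq, Discrepancy] at hω
    push Not at hω
    obtain ⟨A, B, hA, hB, hAB⟩ := hω
    simp only [Set.mem_iUnion]
    refine ⟨A, by simpa [S] using hA, B, by simpa [S] using hB, ?_⟩
    refine hAB.le.trans (le_of_eq ?_)
    rw [Finset.sum_mul]
    simp_rw [Finset.sum_mul]
    rw [← Finset.sum_filter_add_sum_filter_not Finset.univ (fun i => i ∈ A)]
    rw [Finset.sum_eq_zero (s := Finset.univ.filter fun i => i ∉ A), add_zero,
      Finset.filter_univ_mem]
    · refine Finset.sum_congr rfl fun i hi => ?_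
      simp [hi, mul_comm]
    · intro i hi
      have : i ∉ A := by simpa using hi
      simp [this]
  calc μ.real {ω | ¬ Discrepancy (T ω) p θ} ≤ μ.real (⋃ A ∈ S, ⋃ B ∈ S, E A B) :=
        measureReal_mono hsub (measure_ne_top _ _)
    _ ≤ ∑ A ∈ S, ∑ B ∈ S, μ.real (E A B) :=
        (measureReal_biUnion_finset_le _ _).trans
          (Finset.sum_le_sum fun A _ => measureReal_biUnion_finset_le _ _)
    _ ≤ ∑ A ∈ S, ∑ B ∈ S, Real.exp (-w A) * Real.exp (-w B) :=
        Finset.sum_le_sum fun A _ => Finset.sum_le_sum fun B _ => hprob A B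
    _ = (∑ A ∈ S, Real.exp (-w A)) * ∑ A ∈ S, Real.exp (-w A) := by rw [Finset.sum_mul_sum]
    _ ≤ (Fintype.card V : ℝ)⁻¹ * (Fintype.card V : ℝ)⁻¹ := by
        have := sum_exp_neg_entropyWeight_le (V := V)
        gcongr
    _ = _ := by rw [← mul_inv, sq]

lemma sum_half_pow_natAbs_le (B : ℕ) :
    ∑ k ∈ Finset.Icc (-(B : ℤ)) B, ((1 : ℝ) / 2) ^ k.natAbs ≤ 3 - 2 * (1 / 2) ^ B := by
  induction B with
  | zero => simp; norm_num
  | succ B ih =>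
    have hI : Finset.Icc (-((B + 1 : ℕ) : ℤ)) ((B + 1 : ℕ) : ℤ) =
        insert (((B + 1 : ℕ) : ℤ)) (insert (-((B + 1 : ℕ) : ℤ)) (Finset.Icc (-(B : ℤ)) B)) := by
      ext k
      simp only [Finset.mem_insert, Finset.mem_Icc]
      omega
    rw [hI, Finset.sum_insert, Finset.sum_insert]
    · rw [Int.natAbs_neg, Int.natAbs_natCast]
      have : ((1 : ℝ) / 2) ^ (B + 1) = (1 / 2) ^ B / 2 := by rw [pow_succ]; ring
      rw [this]; linarith
    · simp only [Finset.mem_Icc]; omega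
    · simp only [Finset.mem_insert, Finset.mem_Icc]; omega

lemma exp_neg_sq_le (k : ℤ) : Real.exp (-((k : ℝ) ^ 2)) ≤ (1 / 2) ^ k.natAbs := by
  have h1 : Real.exp (-1) ≤ 1 / 2 := by
    rw [Real.exp_neg, inv_le_comm₀ (Real.exp_pos 1) (by norm_num)]
    have := Real.exp_one_gt_d9
    norm_num; linarith
  calc Real.exp (-((k : ℝ) ^ 2)) ≤ Real.exp (k.natAbs * (-1)) := by
        rw [Real.exp_le_exp, Nat.cast_natAbs]
        have h2 : |k| ≤ k ^ 2 := by
          rw [← sq_abs]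
          nlinarith [abs_nonneg k, Int.le_self_sq |k|]
        have h3 : ((|k| : ℤ) : ℝ) ≤ (k : ℝ) ^ 2 := by exact_mod_cast h2
        linarith
    _ = Real.exp (-1) ^ k.natAbs := Real.exp_nat_mul _ _
    _ ≤ _ := by gcongr

/-- The integer vectors of squared length at most `16 * card V`. -/
def latticeBall (V : Type*) [Fintype V] : Finset (V → ℤ) :=
  open Classical in
  (Fintype.piFinset fun _ : V =>
    Finset.Icc (-((16 * Fintype.card V : ℕ) : ℤ)) ((16 * Fintype.card V : ℕ) : ℤ)).filter
    fun z => ∑ i, (z i : ℝ) ^ 2 ≤ 16 * Fintype.card V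

lemma mem_latticeBall {z : V → ℤ} :
    z ∈ latticeBall V ↔ ∑ i, (z i : ℝ) ^ 2 ≤ 16 * Fintype.card V := by
  classical
  refine ⟨fun h => (Finset.mem_filter.1 h).2, fun h => Finset.mem_filter.2 ⟨?_, h⟩⟩
  rw [Fintype.mem_piFinset]
  intro i
  rw [Finset.mem_Icc, ← abs_le]
  have h1 : (z i : ℝ) ^ 2 ≤ 16 * Fintype.card V :=
    (Finset.single_le_sum (f := fun i => (z i : ℝ) ^ 2) (fun _ _ => sq_nonneg _)
      (Finset.mem_univ i)).trans h
  have h2 : z i ^ 2 ≤ ((16 * Fintype.card V : ℕ) : ℤ) := by exact_mod_cast h1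
  rw [← sq_abs] at h2
  nlinarith [abs_nonneg (z i), Int.le_self_sq |z i|]

/-- On the ball, `1 ≤ exp (16 * N) * ∏ exp (-(z i) ^ 2)`. Summed over the whole box the product
factors, and each coordinate contributes at most `3 ≤ exp 2`. -/
lemma card_latticeBall_le :
    ((latticeBall V).card : ℝ) ≤ Real.exp (18 * Fintype.card V) := by
  classical
  set N : ℝ := (Fintype.card V : ℝ) with hN
  have h3 : (3 : ℝ) ≤ Real.exp 2 := by linarith [Real.add_one_le_exp (2 : ℝ)]
  calc ((latticeBall V).card : ℝ) = ∑ z ∈ latticeBall V, (1 : ℝ) := by simp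
    _ ≤ ∑ z ∈ latticeBall V, Real.exp (16 * N) * ∏ i, Real.exp (-((z i : ℝ) ^ 2)) := by
        refine Finset.sum_le_sum fun z hz => ?_
        rw [← Real.exp_sum, ← Real.exp_add, Finset.sum_neg_distrib]
        exact Real.one_le_exp (by linarith [mem_latticeBall.1 hz])
    _ ≤ ∑ z ∈ Fintype.piFinset fun _ : V =>
          Finset.Icc (-((16 * Fintype.card V : ℕ) : ℤ)) ((16 * Fintype.card V : ℕ) : ℤ),
          Real.exp (16 * N) * ∏ i, Real.exp (-((z i : ℝ) ^ 2)) :=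
        Finset.sum_le_sum_of_subset_of_nonneg (Finset.filter_subset _ _) fun _ _ _ => by positivity
    _ = Real.exp (16 * N) * ∏ _i : V,
          ∑ k ∈ Finset.Icc (-((16 * Fintype.card V : ℕ) : ℤ)) ((16 * Fintype.card V : ℕ) : ℤ),
          Real.exp (-((k : ℝ) ^ 2)) := by
        rw [Finset.prod_univ_sum, Finset.mul_sum]
    _ ≤ Real.exp (16 * N) * ∏ _i : V, Real.exp 2 := by
        gcongr
        refine (Finset.sum_le_sum fun k _ => exp_neg_sq_le k).trans ?_
        refine (sum_half_pow_natAbs_le _).trans (le_trans ?_ h3)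
        have : (0 : ℝ) < (1 / 2) ^ (16 * Fintype.card V) := by positivity
        linarith
    _ = _ := by
        rw [Finset.prod_const, Finset.card_univ, ← Real.exp_nat_mul, ← Real.exp_add]
        congr 1; rw [← hN]; ring

/-- Apply Chernoff with coefficients `± z i * z j / D` on light pairs. These are at most 1 in
absolute value, so `exp c - 1 - c ≤ c ^ 2`, and the quadratic terms total at most `p / D ^ 2 * (16 *
N) ^ 2 = 512 * N`. A deviation of `540 * N` leaves `exp (-28 * N)` per sign and vector, against at
most `exp (18 * N)` vectors. -/
theorem measure_not_lightBound_le {μ : Measure Ω} [IsProbabilityMeasure μ]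
    {T : Ω → V → V → ℝ} {t : V → V → ℝ} (h : ExpMomentBound μ T t) {p D : ℝ} (hD : 0 < D)
    (hp : 0 ≤ p) (hV : 1 ≤ Fintype.card V)
    (ht0 : ∀ i j, 0 ≤ t i j) (htp : ∀ i j, t i j ≤ p) (hpN : p * Fintype.card V = 2 * D ^ 2) :
    μ.real {ω | ¬ LightBound (T ω) t D} ≤ Real.exp (-(Fintype.card V : ℝ)) := by
  classical
  set N : ℝ := (Fintype.card V : ℝ) with hN
  have hN1 : 1 ≤ N := by rw [hN]; exact_mod_cast hV
  set c : ℝ → (V → ℤ) → V → V → ℝ := fun σ z i j =>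
    if |(z i : ℝ)| * |(z j : ℝ)| ≤ D then σ * ((z i : ℝ) * z j) / D else 0 with hc
  set E : ℝ → (V → ℤ) → Set Ω := fun σ z =>
    {ω | 540 * N + ∑ i, ∑ j, c σ z i j * t i j ≤ ∑ i, ∑ j, c σ z i j * T ω i j} with hE
  have hprob : ∀ σ z, |σ| = 1 → z ∈ latticeBall V → μ.real (E σ z) ≤ Real.exp (-(28 * N)) := by
    intro σ z hσ hz
    refine (h.chernoff _ _).trans ?_
    rw [Real.exp_le_exp]
    have h2 : ∑ i, ∑ j, t i j * (Real.exp (c σ z i j) - 1) ≤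
        ∑ i, ∑ j, c σ z i j * t i j + 512 * N := by
      calc _ ≤ ∑ i, ∑ j, (c σ z i j * t i j + p / D ^ 2 * ((z i : ℝ) ^ 2 * (z j : ℝ) ^ 2)) := by
            refine Finset.sum_le_sum fun i _ => Finset.sum_le_sum fun j _ => ?_
            by_cases hl : |(z i : ℝ)| * |(z j : ℝ)| ≤ D
            · have hcv : c σ z i j = σ * ((z i : ℝ) * z j) / D := if_pos hl
              have hc1 : |c σ z i j| ≤ 1 := by
                rw [hcv, abs_div, abs_mul, hσ, one_mul, abs_mul, abs_of_pos hD, div_le_one hD]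
                exact hl
              have h3 := (abs_le.1 (Real.abs_exp_sub_one_sub_id_le hc1)).2
              have hσ2 : σ ^ 2 = 1 := by rw [← sq_abs, hσ, one_pow]
              have hcs : c σ z i j ^ 2 = (z i : ℝ) ^ 2 * (z j : ℝ) ^ 2 / D ^ 2 := by
                rw [hcv, div_pow, mul_pow, hσ2]; ring
              have h4 : t i j * (Real.exp (c σ z i j) - 1 - c σ z i j) ≤ p * c σ z i j ^ 2 :=
                (mul_le_mul_of_nonneg_left h3 (ht0 i j)).trans
                  (mul_le_mul_of_nonneg_right (htp i j) (sq_nonneg _))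
              have h5 : p / D ^ 2 * ((z i : ℝ) ^ 2 * (z j : ℝ) ^ 2) = p * c σ z i j ^ 2 := by
                rw [hcs]; ring
              rw [h5]
              linarith
            · have hcv : c σ z i j = 0 := if_neg hl
              rw [hcv, Real.exp_zero, sub_self, mul_zero, zero_mul, zero_add]
              positivity
        _ = ∑ i, ∑ j, c σ z i j * t i j +
            p / D ^ 2 * ((∑ i, (z i : ℝ) ^ 2) * ∑ i, (z i : ℝ) ^ 2) := by
            simp only [Finset.sum_add_distrib, ← Finset.mul_sum, Finset.sum_mul_sum]
        _ ≤ ∑ i, ∑ j, c σ z i j * t i j + p / D ^ 2 * ((16 * N) * (16 * N)) := by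
            have := mem_latticeBall.1 hz
            gcongr
        _ = ∑ i, ∑ j, c σ z i j * t i j + (p * N) / D ^ 2 * 256 * N := by ring
        _ = _ := by rw [hpN]; field_simp; ring
    linarith
  have hsub : {ω | ¬ LightBound (T ω) t D} ⊆
      ⋃ z ∈ latticeBall V, (E 1 z ∪ E (-1) z) := by
    intro ω hω
    simp only [Set.mem_ofPred_eq, LightBound] at hω
    push Not at hω
    obtain ⟨z, hz, hzl⟩ := hω
    simp only [Set.mem_iUnion]
    refine ⟨z, mem_latticeBall.2 hz, ?_⟩
    set S := ∑ i, ∑ j,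
      (if |(z i : ℝ)| * |(z j : ℝ)| ≤ D then (z i : ℝ) * z j * (T ω i j - t i j) else 0)
    have key : ∀ σ : ℝ, ∑ i, ∑ j, c σ z i j * T ω i j - ∑ i, ∑ j, c σ z i j * t i j =
        σ / D * S := by
      intro σ
      simp only [S, ← Finset.sum_sub_distrib, Finset.mul_sum]
      refine Finset.sum_congr rfl fun i _ => Finset.sum_congr rfl fun j _ => ?_
      simp only [hc]
      split_ifs <;> ring
    have hS : 540 * N ≤ |S| / D := by
      rw [le_div_iff₀ hD]; linarith
    rcases abs_cases S with hs | hs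
    · left
      have := key 1
      rw [hs.1] at hS
      have h6 : 1 / D * S = S / D := by ring
      simp only [hE, Set.mem_ofPred_eq]; linarith
    · right
      have := key (-1)
      rw [hs.1] at hS
      have h6 : -1 / D * S = -S / D := by ring
      simp only [hE, Set.mem_ofPred_eq]; linarith
  calc μ.real {ω | ¬ LightBound (T ω) t D} ≤ μ.real (⋃ z ∈ latticeBall V, (E 1 z ∪ E (-1) z)) :=
        measureReal_mono hsub (measure_ne_top _ _)
    _ ≤ ∑ z ∈ latticeBall V, μ.real (E 1 z ∪ E (-1) z) := measureReal_biUnion_finset_le _ _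
    _ ≤ ∑ z ∈ latticeBall V, 2 * Real.exp (-(28 * N)) := by
        refine Finset.sum_le_sum fun z hz => (measureReal_union_le _ _).trans ?_
        have h1 := hprob 1 z (by simp) hz
        have h2 := hprob (-1) z (by simp) hz
        linarith
    _ = (latticeBall V).card * (2 * Real.exp (-(28 * N))) := by
        rw [Finset.sum_const, nsmul_eq_mul]
    _ ≤ Real.exp (18 * N) * (Real.exp (9 * N) * Real.exp (-(28 * N))) := by
        have h1 := card_latticeBall_le (V := V)
        have h2 : 2 ≤ Real.exp (9 * N) := by linarith [Real.add_one_le_exp (9 * N)]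
        gcongr
    _ = _ := by rw [← Real.exp_add, ← Real.exp_add]; ring_nf

/-- With high probability, all the conditions of the deterministic estimate hold. -/
theorem measure_regular_ge {μ : Measure Ω} [IsProbabilityMeasure μ]
    {T : Ω → V → V → ℝ} {t : V → V → ℝ} (h : ExpMomentBound μ T t) {p D : ℝ} (hD : 0 < D)
    (hp : 0 ≤ p) (hV : 1 ≤ Fintype.card V)
    (ht0 : ∀ i j, 0 ≤ t i j) (htp : ∀ i j, t i j ≤ p) (hpN : p * Fintype.card V = 2 * D ^ 2) :
    1 - 18 / Fintype.card V ≤ μ.real {ω | LightBound (T ω) t D ∧ Discrepancy (T ω) p 1 ∧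
      ∀ m : ℕ, (2 : ℝ) ^ m ≤ 16 * Fintype.card V →
        Discrepancy (T ω) p (levelExponent D m)} := by
  set N := Fintype.card V
  set G := {ω | LightBound (T ω) t D ∧ Discrepancy (T ω) p 1 ∧
      ∀ m : ℕ, (2 : ℝ) ^ m ≤ 16 * N → Discrepancy (T ω) p (levelExponent D m)} with hG
  set B : ℝ → Set Ω := fun θ => {ω | ¬ Discrepancy (T ω) p θ}
  have hN1 : (1 : ℝ) ≤ N := by exact_mod_cast hV
  have hcover : (Set.univ : Set Ω) ⊆ G ∪ ({ω | ¬ LightBound (T ω) t D} ∪ (B 1 ∪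
      ⋃ m ∈ Finset.range (16 * N), B (levelExponent D m))) := by
    intro ω _
    by_contra hω
    simp only [Set.mem_union, not_or, Set.mem_iUnion, not_exists, B, Set.mem_ofPred_eq,
      not_not] at hω
    refine hω.1 ⟨hω.2.1, hω.2.2.1, fun m hm => hω.2.2.2 m (Finset.mem_range.2 ?_)⟩
    -- As `m < 2 ^ m`, at most `16 * N` exponents occur, each failing with probability at most `1 /
    -- N ^ 2`.
    have h1 : 2 ^ m ≤ 16 * N := by exact_mod_cast hm
    exact Nat.lt_two_pow_self.trans_le h1
  have h1 : (1 : ℝ) ≤ μ.real G + (μ.real {ω | ¬ LightBound (T ω) t D} + (μ.real (B 1) +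
      ∑ m ∈ Finset.range (16 * N), μ.real (B (levelExponent D m)))) := by
    refine (probReal_univ (μ := μ)).ge.trans ?_
    refine (measureReal_mono hcover (measure_ne_top _ _)).trans ((measureReal_union_le _ _).trans ?_)
    gcongr
    refine (measureReal_union_le _ _).trans ?_
    gcongr
    refine (measureReal_union_le _ _).trans ?_
    gcongr
    exact measureReal_biUnion_finset_le _ _
  have h2 : ∑ m ∈ Finset.range (16 * N), μ.real (B (levelExponent D m)) ≤ 16 / N := by
    refine (Finset.sum_le_sum fun m _ => measure_not_discrepancy_le h ht0 htp _).trans ?_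
    rw [Finset.sum_const, Finset.card_range, nsmul_eq_mul]
    push_cast
    apply le_of_eq
    change 16 * (N : ℝ) * ((N : ℝ) ^ 2)⁻¹ = _
    field_simp
  have h3 : μ.real (B 1) ≤ 1 / N := by
    refine (measure_not_discrepancy_le h ht0 htp _).trans ?_
    change ((N : ℝ) ^ 2)⁻¹ ≤ 1 / N
    rw [one_div]
    gcongr
    nlinarith
  have h4 : μ.real {ω | ¬ LightBound (T ω) t D} ≤ 1 / N := by
    refine (measure_not_lightBound_le h hD hp hV ht0 htp hpN).trans ?_
    change Real.exp (-(N : ℝ)) ≤ 1 / N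
    rw [Real.exp_neg, one_div]
    gcongr
    linarith [Real.add_one_le_exp (N : ℝ)]
  have h5 : (18 : ℝ) / N = 1 / N + (1 / N + 16 / N) := by ring
  linarith

end

/-! ### The law of the observation. -/

lemma sum_upper_eq_sum_sym2 {V : Type*} [Fintype V] [LinearOrder V] (f : V → V → ℝ) :
    ∑ i, ∑ j, (if i < j then f i j else 0) =
      ∑ e : Sym2 V, if e.IsDiag then 0 else f e.inf e.sup := by
  have h := Finset.sum_sym2_filter_not_isDiag (Finset.univ : Finset V)
    (fun e => f e.inf e.sup)
  rw [Finset.sym2_univ, Finset.sum_filter] at h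
  rw [← Finset.sum_product' (f := fun i j => if i < j then f i j else 0), ← Finset.sum_filter]
  simp only [ite_not] at h
  rw [h]
  refine (Finset.sum_congr ?_ fun q hq => ?_).symm
  · ext q
    simp only [Finset.mem_filter, Finset.mem_offDiag, Finset.mem_univ, true_and,
      Finset.mem_product, and_iff_right_iff_imp]
    exact fun h => h.ne
  · have hq' := (Finset.mem_filter.1 hq).2
    simp only [Sym2.inf_mk, Sym2.sup_mk]
    rw [inf_eq_left.2 hq'.le, sup_eq_right.2 hq'.le]

/-- A graph is determined by its adjacency relation, so singletons are measurable. All events and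
functions on the finite sample space are then measurable. -/
instance instDiscreteMeasurableSpaceSimpleGraph {V : Type*} [Finite V] :
    DiscreteMeasurableSpace (SimpleGraph V) := by
  have : MeasurableSingletonClass (SimpleGraph V) := ⟨fun G => by
    have h : ({G} : Set (SimpleGraph V)) = SimpleGraph.Adj ⁻¹' {G.Adj} := by
      ext H
      simp only [Set.mem_singleton_iff, Set.mem_preimage]
      exact ⟨fun h => h ▸ rfl, fun h => SimpleGraph.ext h⟩
    rw [h]
    exact SimpleGraph.measurable_adj (measurableSet_singleton _)⟩
  infer_instance

/-- The mod 2 sum of the labels of the two endpoints of a pair. -/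
def xorLabel {V : Type*} (x : V → ZMod 2) : Sym2 V → ZMod 2 :=
  Sym2.lift ⟨fun i j => x i + x j, fun _ _ => add_comm _ _⟩

lemma xorLabel_mk {V : Type*} (x : V → ZMod 2) (i j : V) : xorLabel x s(i, j) = x i + x j := rfl

open Classical in
/-- The indicator of the event that a pair is an edge with observed label `1`. -/
def edgeLabel {V : Type*} (x : V → ZMod 2) (G : SimpleGraph V) (z : Sym2 V → ZMod 2)
    (e : Sym2 V) : ℝ :=
  if e ∈ G.edgeSet ∧ xorLabel x e + z e = 1 then 1 else 0

lemma labelMatrix_observation {V : Type*} [Fintype V] (x : V → ZMod 2) (G : SimpleGraph V)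
    (z : Sym2 V → ZMod 2) (i j : V) :
    labelMatrix G (observation G x z) i j = edgeLabel x G z s(i, j) := by
  classical
  by_cases h : G.Adj i j
  · have hobs : observation G x z ⟨s(i, j), h⟩ = xorLabel x s(i, j) + z s(i, j) := by
      rw [observation, xorLabel_mk]
      congr 1
      rw [Matrix.mulVec, dotProduct]
      have : ∀ v, (G.incMatrix (ZMod 2)).transpose s(i, j) v * x v =
          (if v = i then x v else 0) + (if v = j then x v else 0) := by
        intro v
        have hne := h.ne
        rw [Matrix.transpose_apply, SimpleGraph.incMatrix_apply']
        by_cases hvi : v = i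
        · subst hvi
          simp [SimpleGraph.incidenceSet, h, hne]
        · by_cases hvj : v = j
          · subst hvj
            simp [SimpleGraph.incidenceSet, h, hne.symm]
          · simp [SimpleGraph.incidenceSet, hvi, hvj]
      rw [Finset.sum_congr rfl fun v _ => this v, Finset.sum_add_distrib]
      simp
    rw [labelMatrix, Matrix.of_apply, dif_pos h, hobs, edgeLabel]
    exact if_congr (and_iff_right h).symm rfl rfl
  · rw [labelMatrix, Matrix.of_apply, dif_neg h, edgeLabel, if_neg fun h' => h h'.1]

/-- The probability that the sum of a fixed label `a` and an independent Bernoulli(`ε`) label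
is `1`. -/
def labelRate (ε : ℝ) (a : ZMod 2) : ℝ := if a = 0 then ε else 1 - ε

lemma integral_noise (ε : unitInterval) (a : ZMod 2) (Q : Prop) [Decidable Q] (c : ℝ) :
    ∫ b, Real.exp (c * if Q ∧ a + b = 1 then 1 else 0) ∂(bernoulliMeasure (1 : ZMod 2) 0 ε) =
      if Q then 1 + labelRate ε a * (Real.exp c - 1) else 1 := by
  rw [integral_bernoulliMeasure]
  have ha : a = 0 ∨ a = 1 := by revert a; decide
  by_cases hQ : Q <;> rcases ha with rfl | rfl <;>
    simp [hQ, labelRate, show (1 : ZMod 2) + 1 = 0 from rfl] <;> ring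

open Classical in
-- The random graph is the image of independent bits on all unordered pairs, the bits on the
-- diagonal being discarded; so the integral of a product over pairs factors.
lemma integral_binomialRandom_prod {V : Type*} [Fintype V] (p : unitInterval)
    (g : Sym2 V → Prop → ℝ) :
    ∫ G, ∏ e, g e (e ∈ G.edgeSet) ∂(SimpleGraph.binomialRandom V p) =
      ∏ e : Sym2 V, if e.IsDiag then g e False else p * g e True + (1 - p) * g e False := by
  rw [SimpleGraph.binomialRandom_eq_map, integral_map
    SimpleGraph.measurable_fromEdgeSet.aemeasurable
    (Measurable.of_discrete (f := fun G : SimpleGraph V =>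
      ∏ e, g e (e ∈ G.edgeSet))).aestronglyMeasurable,
    setBernoulli_eq_map, Measure.infinitePi_eq_pi]
  rw [show (fun q : Sym2 V → Prop => {i | q i}) = MeasurableEquiv.setOfPred from rfl,
    integral_map_equiv]
  have h1 : ∀ q : Sym2 V → Prop,
      (∏ e, g e (e ∈ (SimpleGraph.fromEdgeSet (MeasurableEquiv.setOfPred q)).edgeSet)) =
      ∏ e, g e (q e ∧ ¬ e.IsDiag) := by
    intro q
    refine Finset.prod_congr rfl fun e _ => ?_
    congr 1
    rw [SimpleGraph.edgeSet_fromEdgeSet]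
    rfl
  rw [integral_congr_ae (Eventually.of_forall h1),
    integral_fintype_prod_eq_prod (fun e q => g e (q ∧ ¬ e.IsDiag))]
  refine Finset.prod_congr rfl fun e _ => ?_
  rw [integral_add_measure (Integrable.of_finite) (Integrable.of_finite),
    integral_smul_nnreal_measure, integral_smul_nnreal_measure, integral_dirac, integral_dirac]
  by_cases he : e.IsDiag
  · simp [he, NNReal.smul_def]
    ring
  · simp [he, NNReal.smul_def]

/-- The part of the observed matrix above the diagonal. -/
def upperObservation {n : ℕ} (x : Fin (2 * n) → ZMod 2)
    (ω : SimpleGraph (Fin (2 * n)) × (Sym2 (Fin (2 * n)) → ZMod 2)) (i j : Fin (2 * n)) : ℝ :=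
  if i < j then labelMatrix ω.1 (observation ω.1 x ω.2) i j else 0

/-- The mean of `upperObservation`. -/
def upperMean {n : ℕ} (p ε : ℝ) (x : Fin (2 * n) → ZMod 2) (i j : Fin (2 * n)) : ℝ :=
  if i < j then p * labelRate ε (x i + x j) else 0

lemma sum_mul_upperObservation {n : ℕ} (x : Fin (2 * n) → ZMod 2)
    (ω : SimpleGraph (Fin (2 * n)) × (Sym2 (Fin (2 * n)) → ZMod 2))
    (c : Fin (2 * n) → Fin (2 * n) → ℝ) :
    ∑ i, ∑ j, c i j * upperObservation x ω i j =
      ∑ e : Sym2 (Fin (2 * n)), c e.inf e.sup * edgeLabel x ω.1 ω.2 e := by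
  have h := sum_upper_eq_sum_sym2 fun i j => c i j * edgeLabel x ω.1 ω.2 s(i, j)
  simp only [upperObservation, mul_ite, mul_zero, labelMatrix_observation]
  rw [h]
  refine Finset.sum_congr rfl fun e _ => ?_
  induction e using Sym2.inductionOn with
  | _ i j =>
    split_ifs with he
    · rw [edgeLabel, if_neg, mul_zero]
      exact fun h' => SimpleGraph.not_isDiag_of_mem_edgeSet _ h'.1 he
    · rw [Sym2.inf_mk, Sym2.sup_mk]
      congr 2
      rcases le_total i j with hij | hij
      · rw [inf_eq_left.2 hij, sup_eq_right.2 hij]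
      · rw [inf_eq_right.2 hij, sup_eq_left.2 hij, Sym2.eq_swap]

lemma labelRate_nonneg {ε : ℝ} (h0 : 0 ≤ ε) (h1 : ε ≤ 1) (a : ZMod 2) : 0 ≤ labelRate ε a := by
  unfold labelRate; split_ifs <;> linarith

lemma labelRate_le_one {ε : ℝ} (h0 : 0 ≤ ε) (h1 : ε ≤ 1) (a : ZMod 2) : labelRate ε a ≤ 1 := by
  unfold labelRate; split_ifs <;> linarith

instance (n : ℕ) (p ε : unitInterval) : IsProbabilityMeasure (law n p ε) := by
  unfold law; infer_instance

/-- Integrating first the noise and then the graph gives a product over pairs, since the upper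
triangle uses each pair once. The factor of a pair is `1 + p * r * (exp c - 1)` with `r` its label
rate, and `1 + y ≤ exp y`. -/
theorem expMomentBound_law (n : ℕ) (p ε : unitInterval) (x : Fin (2 * n) → ZMod 2) :
    ExpMomentBound (law n p ε) (upperObservation x) (upperMean p ε x) := by
  classical
  intro c
  refine ⟨Integrable.of_finite, ?_⟩
  set C : Sym2 (Fin (2 * n)) → ℝ := fun e => c e.inf e.sup with hC
  have hinner : ∀ G : SimpleGraph (Fin (2 * n)),
      ∫ z, Real.exp (∑ i, ∑ j, c i j * upperObservation x (G, z) i j)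
        ∂(Measure.pi fun _ : Sym2 (Fin (2 * n)) => bernoulliMeasure (1 : ZMod 2) 0 ε) =
      ∏ e : Sym2 (Fin (2 * n)), if e ∈ G.edgeSet then
        1 + labelRate ε (xorLabel x e) * (Real.exp (C e) - 1) else 1 := by
    intro G
    simp only [sum_mul_upperObservation, Real.exp_sum]
    have h := integral_fintype_prod_eq_prod
      (μ := fun _ : Sym2 (Fin (2 * n)) => bernoulliMeasure (1 : ZMod 2) 0 ε)
      (fun e b => Real.exp (C e * if e ∈ G.edgeSet ∧ xorLabel x e + b = 1 then 1 else 0))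
    refine Eq.trans ?_ (h.trans (Finset.prod_congr rfl fun e _ => integral_noise _ _ _ _))
    refine integral_congr_ae (Eventually.of_forall fun z => Finset.prod_congr rfl fun e _ => ?_)
    simp only [edgeLabel]
    congr!
  have hmean : ∑ i, ∑ j, upperMean p ε x i j * (Real.exp (c i j) - 1) =
      ∑ e : Sym2 (Fin (2 * n)), if e.IsDiag then 0 else
        p * labelRate ε (xorLabel x e) * (Real.exp (C e) - 1) := by
    have h := sum_upper_eq_sum_sym2 fun i j : Fin (2 * n) =>
      p * labelRate ε (x i + x j) * (Real.exp (c i j) - 1)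
    simp only [upperMean, ite_mul, zero_mul]
    rw [h]
    refine Finset.sum_congr rfl fun e _ => ?_
    congr 4
    induction e using Sym2.inductionOn with
    | _ i j =>
      rw [Sym2.inf_mk, Sym2.sup_mk, xorLabel_mk]
      rcases le_total i j with hij | hij
      · rw [inf_eq_left.2 hij, sup_eq_right.2 hij]
      · rw [inf_eq_right.2 hij, sup_eq_left.2 hij, add_comm]
  have hprod : ∫ ω, Real.exp (∑ i, ∑ j, c i j * upperObservation x ω i j) ∂(law n p ε) =
      ∏ e : Sym2 (Fin (2 * n)), if e.IsDiag then 1 else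
        p * (1 + labelRate ε (xorLabel x e) * (Real.exp (C e) - 1)) + (1 - p) * 1 := by
    rw [law, integral_prod _ Integrable.of_finite,
      integral_congr_ae (Eventually.of_forall hinner)]
    have h := integral_binomialRandom_prod p (fun e : Sym2 (Fin (2 * n)) => fun Q : Prop =>
      if Q then 1 + labelRate ε (xorLabel x e) * (Real.exp (C e) - 1) else 1)
    simp only [if_true, if_false] at h
    convert h
  rw [hprod, hmean, Real.exp_sum]
  have hfac : ∀ e, 0 ≤ labelRate ε (xorLabel x e) ∧ labelRate ε (xorLabel x e) ≤ 1 := fun e =>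
    ⟨labelRate_nonneg ε.2.1 ε.2.2 _, labelRate_le_one ε.2.1 ε.2.2 _⟩
  refine Finset.prod_le_prod (fun e _ => ?_) fun e _ => ?_
  · split_ifs
    · exact zero_le_one
    · have h1 : 0 ≤ 1 + labelRate ε (xorLabel x e) * (Real.exp (C e) - 1) := by
        nlinarith [hfac e, mul_nonneg (hfac e).1 (Real.exp_pos (C e)).le]
      have h2 := p.2.1
      have h3 := p.2.2
      exact add_nonneg (mul_nonneg h2 h1) (by linarith)
  · split_ifs
    · rw [Real.exp_zero]
    · have := Real.add_one_le_exp
        ((p : ℝ) * labelRate ε (xorLabel x e) * (Real.exp (C e) - 1))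
      linarith

/-! ### Operator norms, perturbation of the top eigenplane, and rounding. -/

section

section Operator

variable {E : Type*} [NormedAddCommGroup E] [InnerProductSpace ℝ E]

/-- A symmetric operator is bounded by any bound for its quadratic form. -/
lemma norm_le_of_abs_inner_le {L : E →L[ℝ] E} (hL : (L : E →ₗ[ℝ] E).IsSymmetric) {k : ℝ}
    (h : ∀ u, |inner ℝ u (L u)| ≤ k * ‖u‖ ^ 2) (u : E) : ‖L u‖ ≤ k * ‖u‖ := by
  rcases eq_or_ne (L u) 0 with h0 | h0
  · rw [h0, norm_zero]
    rcases eq_or_ne u 0 with hu | hu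
    · simp [hu]
    · have h1 := (abs_nonneg _).trans (h u)
      have h2 : 0 < ‖u‖ := norm_pos_iff.2 hu
      have h3 : 0 ≤ k := by
        by_contra hk
        nlinarith [pow_pos h2 2]
      positivity
  · have hLu : 0 < ‖L u‖ := norm_pos_iff.2 h0
    -- Polarization: `w` points along `L u` and has the length of `u`, so the parallelogram law
    -- makes the two quadratic forms bound `⟪w, L u⟫ = ‖u‖ * ‖L u‖`.
    set r := ‖u‖ / ‖L u‖ with hr
    set w := r • L u with hw
    have hwn : ‖w‖ = ‖u‖ := by
      rw [hw, norm_smul, hr, Real.norm_of_nonneg (by positivity)]; field_simp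
    have hs : inner ℝ w (L u) = inner ℝ u (L w) := by
      rw [real_inner_comm]; exact hL u w
    have h1 : inner ℝ (u + w) (L (u + w)) - inner ℝ (u - w) (L (u - w)) =
        4 * inner ℝ w (L u) := by
      simp only [map_add, map_sub, inner_add_left, inner_add_right, inner_sub_left,
        inner_sub_right, hs]
      ring
    have h2 := (abs_le.1 (h (u + w))).2
    have h3 := (abs_le.1 (h (u - w))).1
    have h4 := parallelogram_law_with_norm ℝ u w
    have h5 : inner ℝ w (L u) = ‖u‖ * ‖L u‖ := by
      rw [hw, real_inner_smul_left, real_inner_self_eq_norm_sq, hr]; field_simp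
    rw [h5] at h1
    rw [hwn] at h4
    have h6 : 4 * (‖u‖ * ‖L u‖) ≤ 4 * (‖u‖ * (k * ‖u‖)) := by
      have h7 : k * ‖u + w‖ ^ 2 + k * ‖u - w‖ ^ 2 = k * (2 * (‖u‖ ^ 2 + ‖u‖ ^ 2)) := by
        rw [← mul_add, h4]
      linarith
    rcases eq_or_ne u 0 with hu | hu
    · simp [hu]
    · have h7 : 0 < ‖u‖ := norm_pos_iff.2 hu
      nlinarith [le_of_mul_le_mul_left (a := 4 * ‖u‖) (b := ‖L u‖) (c := k * ‖u‖) (by linarith)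
        (by positivity)]

lemma exists_unit_pair (s t : ℝ) : ∃ a b : ℝ, a ^ 2 + b ^ 2 = 1 ∧ a * s + b * t = 0 := by
  by_cases h : s ^ 2 + t ^ 2 = 0
  · have hs : s = 0 := by nlinarith [sq_nonneg s, sq_nonneg t]
    have ht : t = 0 := by nlinarith [sq_nonneg s, sq_nonneg t]
    exact ⟨1, 0, by norm_num, by simp [hs, ht]⟩
  · have hpos : 0 < s ^ 2 + t ^ 2 := lt_of_le_of_ne (by positivity) (Ne.symm h)
    refine ⟨t / √(s ^ 2 + t ^ 2), -s / √(s ^ 2 + t ^ 2), ?_, by ring⟩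
    rw [div_pow, div_pow, Real.sq_sqrt hpos.le]
    field_simp
    ring

variable {ι : Type*} [Fintype ι]

lemma OrthonormalBasis.norm_sum_smul_sq (b : OrthonormalBasis ι ℝ E) (c : ι → ℝ) :
    ‖∑ i, c i • b i‖ ^ 2 = ∑ i, c i ^ 2 := by
  rw [← b.sum_sq_norm_inner_right]
  refine Finset.sum_congr rfl fun i _ => ?_
  rw [b.orthonormal.inner_right_fintype, Real.norm_eq_abs, sq_abs]

/-- If an operator `f`, diagonal in an orthonormal basis, is `κ`-close to an operator acting on the
orthogonal pair `u₁, u₂` by factors `a₁, a₂` of absolute value at least `l`, then the two largest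
eigenvalues of `f` are at least `l - κ` in absolute value. -/
lemma le_abs_top_eigenvalue {f g : E →ₗ[ℝ] E} {κ l : ℝ}
    (hfg : ∀ u, ‖f u - g u‖ ≤ κ * ‖u‖) {u₁ u₂ : E} {a₁ a₂ N : ℝ} (hN : 0 < N)
    (h12 : inner ℝ u₁ u₂ = (0 : ℝ)) (h1 : ‖u₁‖ ^ 2 = N) (h2 : ‖u₂‖ ^ 2 = N)
    (hg1 : g u₁ = a₁ • u₁) (hg2 : g u₂ = a₂ • u₂) (ha1 : l ≤ |a₁|) (ha2 : l ≤ |a₂|) (hl : 0 ≤ l)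
    (b : OrthonormalBasis ι ℝ E) (μ : ι → ℝ) (hb : ∀ i, f (b i) = μ i • b i) (S : Finset ι)
    (hS : S.card = 2) (hdom : ∀ i ∈ S, ∀ j ∉ S, |μ j| ≤ |μ i|) (i : ι) (hi : i ∈ S) :
    l - κ ≤ |μ i| := by
  classical
  obtain ⟨i', hi'⟩ : ∃ i', S = {i, i'} := by
    obtain ⟨x, y, hxy, rfl⟩ := Finset.card_eq_two.1 hS
    rcases Finset.mem_insert.1 hi with rfl | h
    · exact ⟨y, rfl⟩
    · rw [Finset.mem_singleton] at h
      subst h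
      exact ⟨x, Finset.pair_comm _ _⟩
  -- Min-max argument: the span of `u₁, u₂` contains a nonzero `w` orthogonal to the other chosen
  -- eigenvector, and on the orthogonal complement of that vector `f` stretches by at most `|μ i|`.
  obtain ⟨s, t, hst, hst0⟩ := exists_unit_pair (inner ℝ (b i') u₁) (inner ℝ (b i') u₂)
  have hnorm : ∀ c d : ℝ, ‖c • u₁ + d • u₂‖ ^ 2 = (c ^ 2 + d ^ 2) * N := by
    intro c d
    rw [norm_add_sq_real, norm_smul, norm_smul, mul_pow, mul_pow, h1, h2, real_inner_smul_left,
      real_inner_smul_right, h12, Real.norm_eq_abs, Real.norm_eq_abs, sq_abs, sq_abs]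
    ring
  set w := s • u₁ + t • u₂ with hw
  have hwn : ‖w‖ ^ 2 = N := by rw [hw, hnorm, hst, one_mul]
  have hwpos : 0 < ‖w‖ := by
    by_contra h
    have : ‖w‖ = 0 := le_antisymm (not_lt.1 h) (norm_nonneg _)
    rw [this] at hwn; norm_num at hwn; linarith
  have hwi' : inner ℝ (b i') w = (0 : ℝ) := by
    rw [hw, inner_add_right, real_inner_smul_right, real_inner_smul_right]
    exact hst0
  have hfw : ‖f w‖ ≤ |μ i| * ‖w‖ := by
    refine abs_le_of_sq_le_sq' ?_ (by positivity) |>.2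
    have hexp : f w = ∑ j, (inner ℝ (b j) w * μ j) • b j := by
      conv_lhs => rw [← b.sum_repr' w]
      rw [map_sum]
      exact Finset.sum_congr rfl fun j _ => by rw [map_smul, hb, smul_smul]
    rw [hexp, OrthonormalBasis.norm_sum_smul_sq, mul_pow, ← b.sum_sq_norm_inner_right w,
      Finset.mul_sum]
    refine Finset.sum_le_sum fun j _ => ?_
    rw [Real.norm_eq_abs, sq_abs, sq_abs]
    by_cases hj : j = i'
    · rw [hj, hwi']; simp
    · have : |μ j| ≤ |μ i| := by
        by_cases hji : j = i
        · rw [hji]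
        · exact hdom i hi j (by rw [hi']; simp [hji, hj])
      have h3 : μ j ^ 2 ≤ μ i ^ 2 := sq_le_sq.2 this
      rw [mul_pow, mul_comm]
      gcongr
  have hgw : l * ‖w‖ ≤ ‖g w‖ := by
    refine abs_le_of_sq_le_sq' ?_ (norm_nonneg _) |>.2
    have : g w = (s * a₁) • u₁ + (t * a₂) • u₂ := by
      rw [hw, map_add, map_smul, map_smul, hg1, hg2, smul_smul, smul_smul]
    rw [this, hnorm, mul_pow, hwn]
    have h3 : l ^ 2 ≤ a₁ ^ 2 := sq_le_sq.2 (by rwa [abs_of_nonneg hl])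
    have h4 : l ^ 2 ≤ a₂ ^ 2 := sq_le_sq.2 (by rwa [abs_of_nonneg hl])
    gcongr
    calc l ^ 2 = s ^ 2 * l ^ 2 + t ^ 2 * l ^ 2 := by rw [← add_mul, hst, one_mul]
      _ ≤ s ^ 2 * a₁ ^ 2 + t ^ 2 * a₂ ^ 2 := by gcongr
      _ = _ := by ring
  have hd := hfg w
  have h5 : ‖g w‖ ≤ ‖f w‖ + ‖f w - g w‖ := by
    have := norm_sub_norm_le (g w) (f w)
    rw [norm_sub_rev] at this
    linarith
  have h6 : (l - κ) * ‖w‖ ≤ |μ i| * ‖w‖ := by linarith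
  exact le_of_mul_le_mul_right h6 hwpos

/-- Vectors in the span of eigenvectors with large eigenvalues have small preimages. -/
lemma exists_preimage_of_mem_span {f : E →ₗ[ℝ] E} {l : ℝ} (hl : 0 < l)
    (b : OrthonormalBasis ι ℝ E) (μ : ι → ℝ) (hb : ∀ i, f (b i) = μ i • b i) (S : Finset ι)
    (hμ : ∀ i ∈ S, l ≤ |μ i|) {v : E} (hv : v ∈ Submodule.span ℝ (b '' (S : Set ι))) :
    ∃ u, f u = v ∧ ‖u‖ ≤ ‖v‖ / l := by
  classical
  have hv0 : ∀ j ∉ S, inner ℝ (b j) v = (0 : ℝ) := by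
    intro j hj
    induction hv using Submodule.span_induction with
    | mem x hx =>
      obtain ⟨i, hi, rfl⟩ := hx
      exact b.orthonormal.inner_eq_zero fun h => hj (h ▸ hi)
    | zero => exact inner_zero_right _
    | add x y _ _ hx hy => rw [inner_add_right, hx, hy, add_zero]
    | smul a x _ hx => rw [real_inner_smul_right, hx, mul_zero]
  refine ⟨∑ j, (if j ∈ S then inner ℝ (b j) v / μ j else 0) • b j, ?_, ?_⟩
  · conv_rhs => rw [← b.sum_repr' v]
    rw [map_sum]
    refine Finset.sum_congr rfl fun j _ => ?_
    rw [map_smul, hb, smul_smul]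
    congr 1
    split_ifs with hj
    · have : μ j ≠ 0 := fun h => by
        have := hμ j hj
        rw [h, abs_zero] at this; linarith
      field_simp
    · rw [hv0 j hj, zero_mul]
  · refine abs_le_of_sq_le_sq' ?_ (by positivity) |>.2
    rw [OrthonormalBasis.norm_sum_smul_sq, div_pow, ← b.sum_sq_norm_inner_right v, Finset.sum_div]
    refine Finset.sum_le_sum fun j _ => ?_
    rw [Real.norm_eq_abs, sq_abs]
    split_ifs with hj
    · rw [div_pow]
      have h1 : l ^ 2 ≤ μ j ^ 2 := sq_le_sq.2 (by rw [abs_of_pos hl]; exact hμ j hj)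
      gcongr
    · rw [zero_pow two_ne_zero]; positivity

/-- A unit vector orthogonal to `u₁` in the span of the two top eigenvectors of `f` is close to the
line spanned by `u₂`. -/
lemma exists_smul_add_of_mem_top {f g : E →ₗ[ℝ] E} {κ l : ℝ}
    (hfg : ∀ u, ‖f u - g u‖ ≤ κ * ‖u‖) {u₁ u₂ : E} {N a₁ a₂ : ℝ} (hN : 0 < N)
    (h12 : inner ℝ u₁ u₂ = (0 : ℝ)) (h1 : ‖u₁‖ ^ 2 = N) (h2 : ‖u₂‖ ^ 2 = N)
    (hg : ∀ u, g u = (a₁ * inner ℝ u₁ u / N) • u₁ + (a₂ * inner ℝ u₂ u / N) • u₂)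
    (ha1 : l ≤ |a₁|) (ha2 : l ≤ |a₂|) (hκ : 0 ≤ κ) (hl : κ < l)
    (b : OrthonormalBasis ι ℝ E) (μ : ι → ℝ) (hb : ∀ i, f (b i) = μ i • b i) (S : Finset ι)
    (hS : S.card = 2) (hdom : ∀ i ∈ S, ∀ j ∉ S, |μ j| ≤ |μ i|) {v : E}
    (hv : v ∈ Submodule.span ℝ (b '' (S : Set ι))) (hv1 : inner ℝ u₁ v = (0 : ℝ))
    (hvn : ‖v‖ = 1) :
    ∃ (c : ℝ) (e : E), v = c • u₂ + e ∧ ‖e‖ ≤ κ / (l - κ) := by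
  have hg1 : g u₁ = a₁ • u₁ := by
    rw [hg, real_inner_self_eq_norm_sq, h1, real_inner_comm, h12]
    rw [mul_div_assoc, div_self hN.ne']; simp
  have hg2 : g u₂ = a₂ • u₂ := by
    rw [hg, real_inner_self_eq_norm_sq, h2, h12]
    rw [mul_div_assoc a₂, div_self hN.ne']; simp
  have hlκ : 0 < l - κ := by linarith
  obtain ⟨u, hu, hun⟩ := exists_preimage_of_mem_span hlκ b μ hb S
    (le_abs_top_eigenvalue hfg hN h12 h1 h2 hg1 hg2 ha1 ha2 (by linarith) b μ hb S hS hdom) hv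
  rw [hvn] at hun
  set r := f u - g u with hr
  have hrn : ‖r‖ ≤ κ / (l - κ) := by
    calc ‖r‖ ≤ κ * ‖u‖ := hfg u
      _ ≤ κ * (1 / (l - κ)) := by gcongr
      _ = _ := by ring
  have hvr : v = (a₁ * inner ℝ u₁ u / N) • u₁ + (a₂ * inner ℝ u₂ u / N) • u₂ + r := by
    rw [hr, hu, hg]; abel
  -- Orthogonality of `v` to `u₁` makes the `u₁` term cancel the `u₁` component of `r`. The error is
  -- thus a projection of `r`, no longer than `r`.
  have hcoef : a₁ * inner ℝ u₁ u / N = -(inner ℝ u₁ r / N) := by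
    rw [hvr, inner_add_right, inner_add_right, real_inner_smul_right, real_inner_smul_right, h12,
      real_inner_self_eq_norm_sq, h1] at hv1
    rw [← neg_div, eq_div_iff hN.ne']
    linarith
  refine ⟨a₂ * inner ℝ u₂ u / N, r - (inner ℝ u₁ r / N) • u₁, ?_, le_trans ?_ hrn⟩
  · conv_lhs => rw [hvr, hcoef]
    rw [neg_smul]; abel
  · refine abs_le_of_sq_le_sq' ?_ (norm_nonneg _) |>.2
    rw [norm_sub_sq_real, real_inner_smul_right, norm_smul, mul_pow, h1, Real.norm_eq_abs, sq_abs,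
      real_inner_comm u₁ r]
    have : (0 : ℝ) ≤ inner ℝ u₁ r ^ 2 / N := by positivity
    have h3 : (inner ℝ u₁ r / N) ^ 2 * N = inner ℝ u₁ r ^ 2 / N := by field_simp
    have h4 : inner ℝ u₁ r / N * inner ℝ u₁ r = inner ℝ u₁ r ^ 2 / N := by ring
    linarith

end Operator

variable {V : Type*} [Fintype V]

/-- Rounding is towards zero, so that the rounded vector is no longer than the original one. -/
lemma exists_int_abs_le_abs (a : ℝ) : ∃ z : ℤ, |(z : ℝ)| ≤ |a| ∧ |a - z| ≤ 1 := by
  rcases le_total 0 a with h | h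
  · refine ⟨⌊a⌋, ?_, ?_⟩
    · have h0 : (0 : ℝ) ≤ ⌊a⌋ := by exact_mod_cast Int.floor_nonneg.2 h
      rw [abs_of_nonneg h, abs_of_nonneg h0]
      exact Int.floor_le a
    · rw [abs_le]
      constructor <;> linarith [Int.floor_le a, Int.lt_floor_add_one a]
  · refine ⟨⌈a⌉, ?_, ?_⟩
    · have h0 : (⌈a⌉ : ℝ) ≤ 0 := by exact_mod_cast Int.ceil_le.2 (by simpa using h)
      rw [abs_of_nonpos h, abs_of_nonpos h0]
      linarith [Int.le_ceil a]
    · rw [abs_le]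
      constructor <;> linarith [Int.le_ceil a, Int.ceil_lt_add_one a]

/-- The norm of a symmetric matrix is controlled by its quadratic form on integer vectors. -/
lemma norm_toEuclideanCLM_le [DecidableEq V] {A : Matrix V V ℝ} (hA : A.IsSymm) {K : ℝ}
    (hV : 1 ≤ Fintype.card V)
    (h : ∀ z : V → ℤ, ∑ i, (z i : ℝ) ^ 2 ≤ 16 * Fintype.card V →
      |∑ i, ∑ j, (z i : ℝ) * z j * A i j| ≤ K * Fintype.card V) (u : EuclideanSpace ℝ V) :
    ‖Matrix.toEuclideanCLM (𝕜 := ℝ) A u‖ ≤ K / 8 * ‖u‖ := by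
  set L := Matrix.toEuclideanCLM (𝕜 := ℝ) A with hL
  set N : ℝ := (Fintype.card V : ℝ) with hN
  have hN0 : 0 < N := by rw [hN]; exact_mod_cast hV
  have hin : ∀ x y : EuclideanSpace ℝ V, inner ℝ x (L y) = ∑ i, ∑ j, x i * y j * A i j := by
    intro x y
    rw [hL, Matrix.inner_toEuclideanCLM, dotProduct]
    refine Finset.sum_congr rfl fun i _ => ?_
    rw [Matrix.mulVec, dotProduct, Finset.mul_sum]
    exact Finset.sum_congr rfl fun j _ => by ring
  have hsymm : (L : EuclideanSpace ℝ V →ₗ[ℝ] EuclideanSpace ℝ V).IsSymmetric := by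
    intro x y
    change inner ℝ (L x) y = inner ℝ x (L y)
    rw [real_inner_comm, hin, hin, Finset.sum_comm]
    refine Finset.sum_congr rfl fun i _ => Finset.sum_congr rfl fun j _ => ?_
    rw [hA.apply]; ring
  have hunit : ∀ x : EuclideanSpace ℝ V, ‖x‖ ≤ 1 → |inner ℝ x (L x)| ≤ K / 16 + ‖L‖ / 2 := by
    intro x hx
    -- Scaling by `4 * √N` turns the unit ball into the ball of squared radius `16 * N`, and
    -- rounding then moves a unit vector by at most `√N / k = 1 / 4`.
    set k := 4 * √N with hk
    have hsq : √N * √N = N := Real.mul_self_sqrt hN0.le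
    have hk0 : 0 < k := by positivity
    have hk2 : k ^ 2 = 16 * N := by rw [hk]; nlinarith
    choose z hz1 hz2 using fun i => exists_int_abs_le_abs (k * x i)
    set y : EuclideanSpace ℝ V := WithLp.toLp 2 fun i => (z i : ℝ) / k with hy
    have hx2 : ∑ i, x i ^ 2 ≤ 1 := by
      rw [← EuclideanSpace.real_norm_sq_eq]
      nlinarith [norm_nonneg x]
    have hzsum : ∑ i, (z i : ℝ) ^ 2 ≤ 16 * N := by
      calc ∑ i, (z i : ℝ) ^ 2 ≤ ∑ i, (k * x i) ^ 2 :=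
            Finset.sum_le_sum fun i _ => sq_le_sq.2 (hz1 i)
        _ = 16 * N * ∑ i, x i ^ 2 := by
            rw [Finset.mul_sum]; exact Finset.sum_congr rfl fun i _ => by rw [mul_pow, hk2]
        _ ≤ _ := by nlinarith
    have hyn : ‖y‖ ≤ 1 := by
      rw [← sq_le_one_iff₀ (norm_nonneg _), EuclideanSpace.real_norm_sq_eq]
      calc ∑ i, y i ^ 2 = (∑ i, (z i : ℝ) ^ 2) / (16 * N) := by
            rw [Finset.sum_div]
            exact Finset.sum_congr rfl fun i _ => by simp only [hy]; rw [div_pow, hk2]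
        _ ≤ 1 := (div_le_one (by positivity)).2 hzsum
    have hxy : ‖x - y‖ ≤ 1 / 4 := by
      refine abs_le_of_sq_le_sq' ?_ (by norm_num) |>.2
      rw [EuclideanSpace.real_norm_sq_eq]
      calc ∑ i, (x - y) i ^ 2 ≤ ∑ _i : V, 1 / (16 * N) := by
            refine Finset.sum_le_sum fun i _ => ?_
            have h1 : (x - y) i = (k * x i - z i) / k := by
              simp only [hy, PiLp.sub_apply]; field_simp
            rw [h1, div_pow, hk2]
            gcongr
            rw [sq_le_one_iff_abs_le_one]
            exact hz2 i
        _ = _ := by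
            rw [Finset.sum_const, Finset.card_univ, nsmul_eq_mul, ← hN]; field_simp; norm_num
    have hyy : |inner ℝ y (L y)| ≤ K / 16 := by
      have h1 : inner ℝ y (L y) = (∑ i, ∑ j, (z i : ℝ) * z j * A i j) / (16 * N) := by
        rw [hin, Finset.sum_div]
        refine Finset.sum_congr rfl fun i _ => ?_
        rw [Finset.sum_div]
        refine Finset.sum_congr rfl fun j _ => ?_
        rw [← hk2]; simp only [hy]; field_simp
      rw [h1, abs_div, abs_of_pos (by positivity : 0 < 16 * N), div_le_iff₀ (by positivity)]
      refine (h z hzsum).trans_eq ?_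
      ring
    have hsplit : inner ℝ x (L x) =
        inner ℝ y (L y) + inner ℝ (x - y) (L x) + inner ℝ y (L (x - y)) := by
      rw [map_sub, inner_sub_left, inner_sub_right]; ring
    have h1 : |inner ℝ (x - y) (L x)| ≤ 1 / 4 * ‖L‖ := by
      refine (abs_real_inner_le_norm _ _).trans ?_
      have : ‖L x‖ ≤ ‖L‖ := (L.le_opNorm x).trans (mul_le_of_le_one_right (norm_nonneg _) hx)
      gcongr
    have h2 : |inner ℝ y (L (x - y))| ≤ 1 * (‖L‖ * (1 / 4)) := by
      refine (abs_real_inner_le_norm _ _).trans ?_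
      have : ‖L (x - y)‖ ≤ ‖L‖ * (1 / 4) := (L.le_opNorm _).trans (by gcongr)
      gcongr
    rw [hsplit]
    refine (abs_add_le _ _).trans (le_trans (add_le_add (abs_add_le _ _) le_rfl) ?_)
    linarith
  have hq : ∀ u, |inner ℝ u (L u)| ≤ (K / 16 + ‖L‖ / 2) * ‖u‖ ^ 2 := by
    intro u
    rcases eq_or_ne u 0 with hu | hu
    · simp [hu]
    · have hu0 : 0 < ‖u‖ := norm_pos_iff.2 hu
      have h1 := hunit (‖u‖⁻¹ • u) (by
        rw [norm_smul, norm_inv, norm_norm, inv_mul_cancel₀ hu0.ne'])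
      rw [map_smul, real_inner_smul_left, real_inner_smul_right, abs_mul, abs_mul,
        abs_of_pos (inv_pos.2 hu0)] at h1
      field_simp at h1
      linarith
  -- The two rounding errors cost `‖L‖ / 4` each, so the bound contains half of `‖L‖` itself and can
  -- be solved for it.
  have hop : ‖L‖ ≤ K / 16 + ‖L‖ / 2 := by
    refine L.opNorm_le_bound ?_ (norm_le_of_abs_inner_le hsymm hq)
    have h0 := (abs_nonneg _).trans (hunit 0 (by simp))
    exact h0
  refine (L.le_opNorm u).trans ?_
  gcongr
  linarith

end

/-! ### From an approximate sign vector to a correct partition. -/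

lemma exists_top_finset {V : Type*} [Fintype V] (f : V → ℝ) {k : ℕ} (hk : k ≤ Fintype.card V) :
    ∃ S : Finset V, S.card = k ∧ ∀ i ∈ S, ∀ j ∉ S, f j ≤ f i := by
  classical
  induction k with
  | zero => exact ⟨∅, rfl, by simp⟩
  | succ k ih =>
    obtain ⟨S, hS, htop⟩ := ih (by omega)
    have hne : (Finset.univ \ S).Nonempty := by
      rw [← Finset.card_pos, Finset.card_sdiff_of_subset (Finset.subset_univ _), Finset.card_univ]
      omega
    obtain ⟨m, hm, hmax⟩ := Finset.exists_max_image _ f hne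
    have hmS : m ∉ S := (Finset.mem_sdiff.1 hm).2
    refine ⟨insert m S, by rw [Finset.card_insert_of_notMem hmS, hS], fun i hi j hj => ?_⟩
    rw [Finset.mem_insert, not_or] at hj
    rcases Finset.mem_insert.1 hi with rfl | hi
    · exact hmax j (by simp [hj.2])
    · exact htop i hi j hj.2

/-- If `f` is `b + e` on `B` and `-b + e` off `B`, then a set of top values of `f` of the size of
`B` misses at most `‖e‖² / b²` points of `B`. -/
lemma card_sdiff_mul_sq_le {V : Type*} [Fintype V] [DecidableEq V] {f e : V → ℝ} {b : ℝ}
    (hb : 0 ≤ b) {B A : Finset V} (hcard : A.card = B.card) (hB : ∀ i ∈ B, f i = b + e i)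
    (hB' : ∀ i ∉ B, f i = -b + e i) (hA : ∀ i ∈ A, ∀ j ∉ A, f j ≤ f i) :
    (B \ A).card * b ^ 2 ≤ ∑ i, e i ^ 2 := by
  have key : ∀ S : Finset V, (∀ i ∈ S, b ≤ |e i|) → S.card * b ^ 2 ≤ ∑ i, e i ^ 2 := by
    intro S hS
    calc S.card * b ^ 2 = ∑ _i ∈ S, b ^ 2 := by rw [Finset.sum_const, nsmul_eq_mul]
      _ ≤ ∑ i ∈ S, e i ^ 2 := by
          refine Finset.sum_le_sum fun i hi => sq_le_sq.2 ?_
          rw [abs_of_nonneg hb]; exact hS i hi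
      _ ≤ _ := Finset.sum_le_sum_of_subset_of_nonneg (Finset.subset_univ _)
          fun _ _ _ => sq_nonneg _
  -- Either all missed points of `B` have error at most `-b`, or one has a larger error. In the
  -- latter case its value is below that of every intruder in `A \ B`, which forces error above `b`
  -- there; and `A \ B` has as many points as `B \ A`.
  by_cases h : ∀ i ∈ B \ A, e i ≤ -b
  · exact key _ fun i hi => le_abs.2 (Or.inr (by linarith [h i hi]))
  · push Not at h
    obtain ⟨i, hi, hie⟩ := h
    rw [Finset.mem_sdiff] at hi
    rw [Finset.card_sdiff_comm hcard.symm]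
    refine key _ fun j hj => le_abs.2 (Or.inl ?_)
    rw [Finset.mem_sdiff] at hj
    have := hA j hj.1 i hi.2
    rw [hB i hi.1, hB' j hj.2] at this
    linarith

lemma gammaCorrect_of_card_sdiff_le {V : Type*} [Fintype V] [DecidableEq V] {n : ℕ} {γ : ℝ}
    (hV : Fintype.card V = 2 * n) {B A : Finset V} (hBn : B.card = n) (hAn : A.card = n)
    (h : ((B \ A).card : ℝ) ≤ γ * n) : GammaCorrect n γ B Bᶜ A Aᶜ := by
  have h1 : (B \ A).card + (B ∩ A).card = n := by
    rw [Finset.card_sdiff_add_card_inter, hBn]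
  have h2 : (Bᶜ ∩ Aᶜ).card = (B ∩ A).card := by
    rw [← Finset.compl_union, Finset.card_compl, hV]
    have := Finset.card_union_add_card_inter B A
    omega
  have h3 : ((B \ A).card : ℝ) + (B ∩ A).card = n := by exact_mod_cast h1
  refine ⟨by linarith, ?_⟩
  rw [h2]; linarith

/-- The `±1` vector of the two communities. -/
def signVector {V : Type*} (x : V → ZMod 2) : EuclideanSpace ℝ V :=
  WithLp.toLp 2 fun i => if x i = 0 then 1 else -1

lemma signVector_apply {V : Type*} (x : V → ZMod 2) (i : V) :
    signVector x i = if x i = 0 then 1 else -1 := rfl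

lemma zmod_two_eq_zero_or_one (a : ZMod 2) : a = 0 ∨ a = 1 := by
  revert a; decide

/-- This identity shows that the mean matrix has rank at most two. The minus sign reflects that
label 1 is likelier across the communities than inside them when `ε < 1 / 2`. -/
lemma labelRate_add (ε : ℝ) {V : Type*} (x : V → ZMod 2) (i j : V) :
    labelRate ε (x i + x j) = 1 / 2 - (1 - 2 * ε) / 2 * (signVector x i * signVector x j) := by
  rw [signVector_apply, signVector_apply]
  rcases zmod_two_eq_zero_or_one (x i) with hi | hi <;>
    rcases zmod_two_eq_zero_or_one (x j) with hj | hj <;>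
    simp [hi, hj, labelRate, show (1 : ZMod 2) + 1 = 0 from rfl] <;> ring

lemma compl_block_one {V : Type*} [Fintype V] [DecidableEq V] (x : V → ZMod 2) :
    (block x 1)ᶜ = block x 0 := by
  ext i
  simp only [block, Finset.mem_compl, Finset.mem_filter, Finset.mem_univ, true_and]
  rcases zmod_two_eq_zero_or_one (x i) with h | h <;> simp [h]

/-- A set of top coordinates of a vector close to a multiple of `signVector x` is a correct
partition. -/
lemma gammaCorrectPartition_of_close {n : ℕ} (hn : 0 < n) {x : Fin (2 * n) → ZMod 2}
    (hx : (block x 1).card = n) {γ δ c : ℝ} {v e : EuclideanSpace ℝ (Fin (2 * n))}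
    (hv : v = c • signVector x + e) (hvn : ‖v‖ = 1) (he : ‖e‖ ≤ δ) (hδ : δ ≤ 1 / 2)
    (hδγ : 4 * δ ≤ γ) (hs : ‖signVector x‖ ^ 2 = 2 * n) {A : Finset (Fin (2 * n))}
    (hA : A.card = n) (htop : ∀ i ∈ A, ∀ j ∉ A, v j ≤ v i) :
    GammaCorrectPartition n γ (block x 0) (block x 1) A Aᶜ := by
  have hcard : Fintype.card (Fin (2 * n)) = 2 * n := Fintype.card_fin _
  have hn' : (0 : ℝ) < n := by exact_mod_cast hn
  have hδ0 : 0 ≤ δ := (norm_nonneg _).trans he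
  have hx0 : (block x 0).card = n := by
    rw [← compl_block_one, Finset.card_compl, hcard, hx]; omega
  -- The `signVector` part has norm at least `1 / 2`, so `c ^ 2 ≥ 1 / (8 * n)`. An error of squared
  -- norm at most `δ ^ 2` then pays for at most `8 * δ ^ 2 * n ≤ 4 * δ * n` misplaced vertices.
  have hc : 1 / 4 ≤ c ^ 2 * (2 * n) := by
    have h1 : 1 / 2 ≤ ‖c • signVector x‖ := by
      have : ‖v‖ ≤ ‖c • signVector x‖ + ‖e‖ := by rw [hv]; exact norm_add_le _ _
      linarith
    have h2 : ‖c • signVector x‖ ^ 2 = c ^ 2 * (2 * n) := by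
      rw [norm_smul, mul_pow, hs, Real.norm_eq_abs, sq_abs]
    nlinarith
  have hfin : ∀ k : ℕ, (k : ℝ) * c ^ 2 ≤ ∑ i, e i ^ 2 → (k : ℝ) ≤ γ * n := by
    intro k hk
    rw [← EuclideanSpace.real_norm_sq_eq] at hk
    have h1 : ‖e‖ ^ 2 ≤ δ ^ 2 := by gcongr
    have h2 : (k : ℝ) * (1 / 4) ≤ (k * c ^ 2) * (2 * n) := by
      rw [mul_assoc]; gcongr
    have h3 : (k * c ^ 2) * (2 * n) ≤ δ ^ 2 * (2 * n) := by gcongr; linarith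
    have h4 : δ ^ 2 ≤ δ * (1 / 2) := by rw [sq]; gcongr
    have h5 : δ ^ 2 * (2 * n) ≤ δ * (1 / 2) * (2 * n) := by gcongr
    have h6 : 4 * δ * n ≤ γ * n := by gcongr
    linarith
  have hval : ∀ i, v i = c * signVector x i + e i := fun i => by
    rw [hv, PiLp.add_apply, PiLp.smul_apply, smul_eq_mul]
  have hm1 : ∀ i, i ∈ block x 1 ↔ x i = 1 := fun i => by simp [block]
  have hm0 : ∀ i, i ∈ block x 0 ↔ x i = 0 := fun i => by simp [block]
  have hcompl0 : (block x 0)ᶜ = block x 1 := by rw [← compl_block_one, compl_compl]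
  rcases le_total 0 c with h0 | h0
  · left
    have h1 := card_sdiff_mul_sq_le (f := v) (e := e) h0 (hA.trans hx0.symm)
      (fun i hi => by rw [hval, signVector_apply, if_pos ((hm0 i).1 hi), mul_one])
      (fun i hi => by rw [hval, signVector_apply, if_neg fun h => hi ((hm0 i).2 h), mul_neg_one])
      htop
    have h2 := gammaCorrect_of_card_sdiff_le hcard hx0 hA (hfin _ h1)
    rwa [hcompl0] at h2
  · right
    have h1 := card_sdiff_mul_sq_le (f := v) (e := e) (neg_nonneg.2 h0) (hA.trans hx.symm)
      (fun i hi => by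
        rw [hval, signVector_apply, (hm1 i).1 hi, if_neg one_ne_zero, mul_neg_one])
      (fun i hi => by
        have : x i = 0 := (zmod_two_eq_zero_or_one (x i)).resolve_right fun h => hi ((hm1 i).2 h)
        rw [hval, signVector_apply, if_pos this]; ring)
      htop
    rw [neg_sq] at h1
    have h2 := gammaCorrect_of_card_sdiff_le hcard hx hA (hfin _ h1)
    rw [compl_block_one] at h2
    exact ⟨h2.2, h2.1⟩

lemma exists_isTopEigenspace {V : Type*} [Fintype V] {A : Matrix V V ℝ} (hA : A.IsSymm)
    (hV : 2 ≤ Fintype.card V) : ∃ U, IsTopEigenspace A U := by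
  classical
  have hH : A.IsHermitian := by
    rw [Matrix.IsHermitian, Matrix.conjTranspose_eq_transpose_of_trivial]; exact hA
  obtain ⟨S, hS, htop⟩ := exists_top_finset (fun i => |hH.eigenvalues i|) hV
  refine ⟨_, hH.eigenvectorBasis, hH.eigenvalues, S, fun i => ?_, hS, htop, rfl⟩
  have h := hH.mulVec_eigenvectorBasis i
  rw [Matrix.toLpLin_apply, h]
  rfl

/-- The spectral theorem gives the plane, and a plane contains a unit vector orthogonal to `v₁` even
when `v₁ = 0`. -/
lemma exists_isSpectralOutput {n : ℕ} (hn : 0 < n) (p : ℝ)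
    {Y : Matrix (Fin (2 * n)) (Fin (2 * n)) ℝ} (hY : (trim Y (20 * p * n)).IsSymm) :
    ∃ V₁ V₂, IsSpectralOutput n p Y V₁ V₂ := by
  have hcard : Fintype.card (Fin (2 * n)) = 2 * n := Fintype.card_fin _
  obtain ⟨U, hU⟩ := exists_isTopEigenspace hY (by rw [hcard]; omega)
  have hU' := hU
  obtain ⟨b, μ, S, -, hS, -, rfl⟩ := hU
  set U := Submodule.span ℝ (b '' (S : Set (Fin (2 * n))))
  obtain ⟨i, j, hij, rfl⟩ := Finset.card_eq_two.1 hS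
  set v₁ := U.starProjection (WithLp.toLp 2 fun _ => (1 : ℝ)) with hv₁
  obtain ⟨s, t, hst, hst0⟩ := exists_unit_pair (inner ℝ v₁ (b i)) (inner ℝ v₁ (b j))
  have hbi : b i ∈ U := Submodule.subset_span ⟨i, by simp, rfl⟩
  have hbj : b j ∈ U := Submodule.subset_span ⟨j, by simp, rfl⟩
  set v₂ := s • b i + t • b j
  have hv₂ : ‖v₂‖ = 1 := by
    have h : ‖v₂‖ ^ 2 = 1 := by
      rw [norm_add_sq_real, norm_smul, norm_smul, b.norm_eq_one, b.norm_eq_one,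
        real_inner_smul_left, real_inner_smul_right, b.orthonormal.inner_eq_zero hij,
        Real.norm_eq_abs, Real.norm_eq_abs, mul_one, mul_one, sq_abs, sq_abs]
      linarith
    nlinarith [norm_nonneg v₂]
  obtain ⟨A, hA, htop⟩ := exists_top_finset (fun i => v₂ i) (k := n) (by rw [hcard]; omega)
  refine ⟨A, Aᶜ, U, v₁, v₂, hU', rfl, U.add_mem (U.smul_mem _ hbi) (U.smul_mem _ hbj), hv₂, ?_, hA,
    htop, rfl⟩
  rw [inner_add_right, real_inner_smul_right, real_inner_smul_right]
  exact hst0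

lemma labelMatrix_observation_symm {V : Type*} [Fintype V] (x : V → ZMod 2) (G : SimpleGraph V)
    (z : Sym2 V → ZMod 2) (i j : V) :
    labelMatrix G (observation G x z) i j = labelMatrix G (observation G x z) j i := by
  rw [labelMatrix_observation, labelMatrix_observation, Sym2.eq_swap]

lemma trim_isSymm {V : Type*} [Fintype V] {Y : Matrix V V ℝ} (hY : ∀ i j, Y i j = Y j i) (k : ℝ) :
    (trim Y k).IsSymm := by
  ext i j
  simp only [Matrix.transpose_apply, trim, Matrix.of_apply]
  rw [hY j i]
  exact if_congr or_comm rfl rfl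

/-- The mean of the observed matrix, up to its diagonal. -/
def meanMatrix {V : Type*} (p ε : ℝ) (x : V → ZMod 2) : Matrix V V ℝ :=
  Matrix.of fun i j => p * labelRate ε (x i + x j)

lemma norm_signVector_sq {n : ℕ} (x : Fin (2 * n) → ZMod 2) : ‖signVector x‖ ^ 2 = 2 * n := by
  rw [EuclideanSpace.real_norm_sq_eq]
  have : ∀ i, signVector x i ^ 2 = 1 := fun i => by
    rw [signVector_apply]; split_ifs <;> norm_num
  rw [Finset.sum_congr rfl fun i _ => this i]
  simp

lemma inner_one_signVector {n : ℕ} {x : Fin (2 * n) → ZMod 2} (hx : (block x 1).card = n) :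
    inner ℝ (WithLp.toLp 2 fun _ => (1 : ℝ)) (signVector x) = (0 : ℝ) := by
  have hx0 : (block x 0).card = n := by
    rw [← compl_block_one, Finset.card_compl, Fintype.card_fin, hx]; omega
  rw [PiLp.inner_apply]
  have h : ∀ i, inner ℝ (1 : ℝ) (signVector x i) =
      (if x i = 0 then (1 : ℝ) else 0) - (if x i = 1 then 1 else 0) := fun i => by
    rw [signVector_apply]
    rcases zmod_two_eq_zero_or_one (x i) with hi | hi <;> simp [hi]
  refine (Finset.sum_congr rfl fun i _ => h i).trans ?_
  rw [Finset.sum_sub_distrib, Finset.sum_boole, Finset.sum_boole]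
  change ((block x 0).card : ℝ) - (block x 1).card = 0
  rw [hx0, hx, sub_self]

lemma meanMatrix_apply_vector {n : ℕ} (hn : 0 < n) (p ε : ℝ) (x : Fin (2 * n) → ZMod 2)
    (u : EuclideanSpace ℝ (Fin (2 * n))) :
    Matrix.toEuclideanLin (meanMatrix p ε x) u =
      (n * p * inner ℝ (WithLp.toLp 2 fun _ => (1 : ℝ)) u / (2 * n)) •
        (WithLp.toLp 2 fun _ => (1 : ℝ)) +
      (-((1 - 2 * ε) * (n * p)) * inner ℝ (signVector x) u / (2 * n)) • signVector x := by
  have hn' : (n : ℝ) ≠ 0 := by positivity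
  ext i
  rw [Matrix.toLpLin_apply, PiLp.add_apply, PiLp.smul_apply, PiLp.smul_apply, PiLp.inner_apply,
    PiLp.inner_apply]
  simp only [Matrix.mulVec, dotProduct, meanMatrix, Matrix.of_apply, labelRate_add,
    RCLike.inner_apply, conj_trivial, smul_eq_mul, mul_one]
  have h : ∀ j, p * (1 / 2 - (1 - 2 * ε) / 2 * (signVector x i * signVector x j)) * u j =
      p / 2 * u j + (-((1 - 2 * ε) * p) / 2 * signVector x i) * (u j * signVector x j) :=
    fun j => by ring
  rw [Finset.sum_congr rfl fun j _ => h j, Finset.sum_add_distrib, ← Finset.mul_sum,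
    ← Finset.mul_sum]
  field_simp

/-- On the event of `measure_regular_ge`, the algorithm succeeds. -/
theorem mem_successEvent_of_regular {n : ℕ} (hn : 0 < n) {p ε : unitInterval} {γ δ : ℝ}
    (hδ0 : 0 < δ) (hδ : δ ≤ 1 / 2) (hδγ : 4 * δ ≤ γ) (hε : (ε : ℝ) < 1 / 2)
    {x : Fin (2 * n) → ZMod 2} (hx : (block x 1).card = n) {D : ℝ} (hD : D ^ 2 = n * (p : ℝ))
    (hDlarge : 10625 * (1 + 1 / δ) ≤ D * (1 - 2 * (ε : ℝ)))
    {ω : SimpleGraph (Fin (2 * n)) × (Sym2 (Fin (2 * n)) → ZMod 2)}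
    (hL : LightBound (upperObservation x ω) (upperMean p ε x) D)
    (hT1 : Discrepancy (upperObservation x ω) p 1)
    (hT : ∀ m : ℕ, (2 : ℝ) ^ m ≤ 16 * Fintype.card (Fin (2 * n)) →
      Discrepancy (upperObservation x ω) p (levelExponent D m)) :
    ω ∈ successEvent n p γ x := by
  have hn' : (0 : ℝ) < n := by exact_mod_cast hn
  have hp0 : (0 : ℝ) ≤ p := p.2.1
  have hp1 : (p : ℝ) ≤ 1 := p.2.2
  have hε0 : (0 : ℝ) ≤ ε := ε.2.1
  have hε1 : (ε : ℝ) ≤ 1 := ε.2.2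
  have hε2 : 0 < 1 - 2 * (ε : ℝ) := by linarith
  have hδinv : 0 < 1 / δ := by positivity
  have hD1 : 1 ≤ D := by
    by_contra h
    push Not at h
    nlinarith
  have hD0 : 0 < D := by linarith
  have hcard : (Fintype.card (Fin (2 * n)) : ℝ) = 2 * n := by
    rw [Fintype.card_fin]; push_cast; ring
  set Y := labelMatrix ω.1 (observation ω.1 x ω.2) with hYdef
  have hYsymm : ∀ i j, Y i j = Y j i := labelMatrix_observation_symm x ω.1 ω.2
  have hY01 : ∀ i j, 0 ≤ Y i j := fun i j => by
    rw [hYdef, labelMatrix_observation, edgeLabel]; split_ifs <;> norm_num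
  have hYd : ∀ i, Y i i = 0 := fun i => by
    rw [hYdef, labelMatrix_observation, edgeLabel, if_neg]
    exact fun h => ω.1.loopless.irrefl i h.1
  have hYT : ∀ i j, Y i j = upperObservation x ω i j + upperObservation x ω j i := by
    intro i j
    rw [upperObservation, upperObservation, ← hYdef]
    rcases lt_trichotomy i j with h | h | h
    · rw [if_pos h, if_neg h.not_gt, add_zero]
    · subst h; simp [hYd]
    · rw [if_neg h.not_gt, if_pos h, zero_add, hYsymm]
  have htrim : (20 : ℝ) * p * n = 20 * D ^ 2 := by rw [hD]; ring
  set A := trim Y (20 * p * n) with hA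
  have hAsymm : A.IsSymm := trim_isSymm hYsymm _
  have hrate : ∀ i j, 0 ≤ (p : ℝ) * labelRate ε (x i + x j) ∧
      (p : ℝ) * labelRate ε (x i + x j) ≤ p := fun i j =>
    ⟨mul_nonneg hp0 (labelRate_nonneg hε0 hε1 _),
      mul_le_of_le_one_right hp0 (labelRate_le_one hε0 hε1 _)⟩
  have hquad : ∀ z : Fin (2 * n) → ℤ, ∑ i, (z i : ℝ) ^ 2 ≤ 16 * Fintype.card (Fin (2 * n)) →
      |∑ i, ∑ j, (z i : ℝ) * z j * (A - meanMatrix p ε x) i j| ≤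
        85000 * D * Fintype.card (Fin (2 * n)) := by
    intro z hz
    have := abs_trim_quadratic_form_le (T := upperObservation x ω) (t := upperMean p ε x)
      (Y := Y) (P := meanMatrix p ε x) hYT
      (fun i j => by rw [upperObservation]; split_ifs; exacts [hY01 i j, le_rfl]) hD0 hp0
      (hp1.trans hD1)
      (fun i j => by rw [upperMean]; split_ifs; exacts [(hrate i j).1, le_rfl])
      (fun i j => by rw [upperMean]; split_ifs; exacts [(hrate i j).2, hp0])
      (fun i j => (hrate i j).1) (fun i j => (hrate i j).2)
      (fun i j hij => by
        rw [upperMean, upperMean, meanMatrix, Matrix.of_apply]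
        rcases lt_or_gt_of_ne hij with h | h
        · rw [if_pos h, if_neg h.not_gt, add_zero]
        · rw [if_neg h.not_gt, if_pos h, zero_add, add_comm (x i)])
      (fun i => by rw [upperMean, if_neg (lt_irrefl i)])
      (by rw [hcard, hD]; ring) hT1 hT hL z hz
    rw [hA, htrim]
    simpa only [Matrix.sub_apply] using this
  have hsub : (A - meanMatrix p ε x).IsSymm := by
    refine hAsymm.sub ?_
    ext i j
    simp only [Matrix.transpose_apply, meanMatrix, Matrix.of_apply, add_comm]
  have hfg : ∀ u, ‖Matrix.toEuclideanLin A u - Matrix.toEuclideanLin (meanMatrix p ε x) u‖ ≤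
      10625 * D * ‖u‖ := by
    intro u
    have h := norm_toEuclideanCLM_le hsub (by rw [Fintype.card_fin]; omega) hquad u
    rw [map_sub, sub_apply] at h
    refine le_trans (le_of_eq rfl) (h.trans_eq (by ring))
  refine ⟨exists_isSpectralOutput hn p hAsymm, ?_⟩
  rintro V₁' V₂' ⟨U, v₁, v₂, ⟨b, μ, S, hb, hS, hdom, rfl⟩, rfl, hv₂, hv₂n, hv₁, hV₁, htop, rfl⟩
  -- The projection is self-adjoint and fixes `v₂`, so `v₂` is orthogonal to the all-ones vector
  -- itself.
  rw [Submodule.inner_starProjection_left_eq_right,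
    Submodule.starProjection_eq_self_iff.2 hv₂] at hv₁
  have hone : ‖(WithLp.toLp 2 fun _ => (1 : ℝ) : EuclideanSpace ℝ (Fin (2 * n)))‖ ^ 2 = 2 * n := by
    rw [EuclideanSpace.real_norm_sq_eq]; simp
  have hl : 10625 * D < (1 - 2 * (ε : ℝ)) * (n * p) := by
    rw [← hD]
    nlinarith [mul_pos hD0 hδinv]
  have hl0 : 0 < (1 - 2 * (ε : ℝ)) * (n * p) := by linarith
  obtain ⟨c, e, hve, hen⟩ := exists_smul_add_of_mem_top (f := Matrix.toEuclideanLin A) hfg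
    (N := 2 * n) (by positivity) (inner_one_signVector hx) hone (norm_signVector_sq x)
    (meanMatrix_apply_vector hn p ε x) (l := (1 - 2 * (ε : ℝ)) * (n * p))
    (by
      rw [abs_of_nonneg (by positivity)]
      have : (0 : ℝ) ≤ n * p := by positivity
      nlinarith)
    (by rw [abs_neg, abs_of_pos hl0]) (by positivity) hl b μ (fun i => by convert hb i) S hS hdom
    hv₂ hv₁ hv₂n
  refine gammaCorrectPartition_of_close hn hx hve hv₂n (hen.trans ?_) hδ hδγ (norm_signVector_sq x)
    hV₁ htop
  -- The bound `κ / (l - κ) ≤ δ` amounts to `κ * (1 + 1 / δ) ≤ l`, which is `hDlarge` multiplied by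
  -- `D`; here `κ = 10625 * D`, where `10625 = 85000 / 8`.
  rw [div_le_iff₀ (by linarith), ← hD]
  have h1 : 10625 * D * (1 + 1 / δ) * δ ≤ D * (D * (1 - 2 * (ε : ℝ))) * δ := by
    rw [mul_comm 10625 D, mul_assoc D]
    gcongr
  have h2 : 10625 * D * (1 + 1 / δ) * δ = 10625 * D * δ + 10625 * D := by field_simp
  nlinarith

end

end CensorBlock

theorem theorem1p5 (γ ε₀ : ℝ) (hγ : 0 < γ) (hε₀ : 0 < ε₀) (hε₀' : ε₀ < 1 / 2) :
    ∃ C₁ C₂ : ℝ, 0 < C₁ ∧ 0 < C₂ ∧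
      ∀ ε : unitInterval, ε₀ ≤ (ε : ℝ) → (ε : ℝ) < 1 / 2 →
        ∃ η : ℕ → ℝ, Tendsto η atTop (𝓝 0) ∧
          ∀ (n : ℕ) (p : unitInterval) (x : Fin (2 * n) → ZMod 2),
            (CensorBlock.block x 1).card = n →
            C₁ / (1 - 2 * (ε : ℝ)) ^ 2 ≤ n * (p : ℝ) →
            C₂ / n ≤ (p : ℝ) →
            1 - η n ≤ (CensorBlock.law n p ε).real (CensorBlock.successEvent n p γ x) := by
  set δ : ℝ := min (1 / 2) (γ / 4) with hδ
  have hδ0 : 0 < δ := lt_min (by norm_num) (by linarith)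
  have hc0 : 0 < 10625 * (1 + 1 / δ) := by positivity
  -- `C₁` is the square of the lower bound required of `D * (1 - 2 * ε)`. The failure probability is
  -- `18 / N = 9 / n`, whatever `p` and `x` are.
  refine ⟨(10625 * (1 + 1 / δ)) ^ 2, 1, by positivity, one_pos, fun ε _ hε =>
    ⟨fun n => 9 / n, tendsto_const_div_atTop_nhds_zero_nat 9, fun n p x hx hnp _ => ?_⟩⟩
  have hε2 : 0 < 1 - 2 * (ε : ℝ) := by linarith
  have hnp0 : 0 < n * (p : ℝ) := lt_of_lt_of_le (by positivity) hnp
  have hn : 0 < n := Nat.pos_of_ne_zero fun h => by rw [h] at hnp0; simp at hnp0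
  set D := √(n * (p : ℝ)) with hDdef
  have hD : D ^ 2 = n * (p : ℝ) := Real.sq_sqrt hnp0.le
  have hD0 : 0 < D := Real.sqrt_pos.2 hnp0
  have hDlarge : 10625 * (1 + 1 / δ) ≤ D * (1 - 2 * (ε : ℝ)) := by
    refine abs_le_of_sq_le_sq' ?_ (by positivity) |>.2
    rw [mul_pow D, hD]
    rwa [div_le_iff₀ (by positivity)] at hnp
  have hp0 : (0 : ℝ) ≤ p := p.2.1
  have hε1 : (ε : ℝ) ≤ 1 := ε.2.2
  have hcard : (Fintype.card (Fin (2 * n)) : ℝ) = 2 * n := by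
    rw [Fintype.card_fin]; push_cast; ring
  have h := CensorBlock.measure_regular_ge (CensorBlock.expMomentBound_law n p ε x) hD0 hp0
    (by rw [Fintype.card_fin]; omega)
    (fun i j => by
      rw [CensorBlock.upperMean]
      split_ifs
      exacts [mul_nonneg hp0 (CensorBlock.labelRate_nonneg ε.2.1 hε1 _), le_rfl])
    (fun i j => by
      rw [CensorBlock.upperMean]
      split_ifs
      exacts [mul_le_of_le_one_right hp0 (CensorBlock.labelRate_le_one ε.2.1 hε1 _), hp0])
    (by rw [hcard, hD]; ring)
  have h9 : (18 : ℝ) / Fintype.card (Fin (2 * n)) = 9 / n := by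
    rw [hcard]
    have : (n : ℝ) ≠ 0 := by positivity
    field_simp; norm_num
  rw [h9] at h
  refine h.trans (measureReal_mono (fun ω hω => ?_) (measure_ne_top _ _))
  exact CensorBlock.mem_successEvent_of_regular hn hδ0 (min_le_left _ _)
    (by linarith [min_le_right (1 / 2) (γ / 4)]) hε hx hD hDlarge hω.1 hω.2.1 hω.2.2
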